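/- Let a fluid move in $\mathbb{R}^3$: let $U\subseteq\mathbb{R}^3$ be open and let $x=\varphi_t(\xi)$, $t\in\mathbb{R}$, $\xi\in U$, be of class $C^3$ in $(t,\xi)$, with $\varphi_0=\mathrm{id}$, each $\varphi_t$ one-to-one on $U$, and $\det(\partial x^i/\partial\xi^j)\neq 0$. Let $D=\{(t,x): x\in\varphi_t(U)\}$, let $u$ be the velocity field on $D$, $u(t,\varphi_t(\xi))=\partial_t\varphi_t(\xi)$, and put $\frac{d}{dt}=\frac{\partial}{\partial t}+u^l\frac{\partial}{\partial x^l}$ (acting on functions on $D$), $\theta_{ij}=\frac12\left(\frac{\partial u_i}{\partial x^j}+\frac{\partial u_j}{\partial x^i}\right)$, $\omega_{ij}=\frac12\left(\frac{\partial u_i}{\partial x^j}-\frac{\partial u_j}{\partial x^i}\right)$. Let the density $\rho>0$, the specific internal energy $E$, the stress tensor $T^{ij}$ (not necessarily symmetric) and the heat flux vector $q^i$ be $C^1$ functions on $D$, and let the external force per unit mass $F^i$ be continuous on $D$. Write $T^{(ij)}=\frac12(T^{ij}+T^{ji})$, $T^{[ij]}=\frac12(T^{ij}-T^{ji})$, and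 let $s_{(n)}^i=T^i{}_jn^j$ be the stress vector for the unit normal $n$; repeated indices are summed from 1 to 3 and raised and lowered with $\delta_{ij}$. A moving region is a family $\Sigma(t)=\varphi_t(\Sigma_0)$, $t\in\mathbb{R}$, where $\Sigma_0\subset U$ is compact and its boundary has finite area and is, except for a set of area zero, a $C^1$ surface with $\Sigma_0$ on one side of it. Boundary integrals are taken with respect to surface area $dS$ and the outward unit normal $n$, $dS_i=n_i\,dS$. Let $$\mathcal K(t)=\frac12\int_{\Sigma(t)}\rho\,\delta_{ij}u^iu^j\,dV,\qquad \mathcal E(t)=\int_{\Sigma(t)}\rho E\,dV .$$ Theorem (The total energy equation). Suppose that mass is conserved, $\frac{d}{dt}\int_{\Sigma(t)}\rho\,dV=0$ for every moving region and every $t$, and that the kinetic energy transfer equation $$\frac{d\mathcal K}{dt}=\int_{\Sigma(t)}\rho\,\delta_{ij}u^iF^j\,dV+\oint_{\partial\Sigma(t)}\delta_{ij}u^is_{(n)}^j\,dS-\int_{\Sigma(t)}\theta_{ij}T^{(ij)}\,dV-\int_{\Sigma(t)}\omega_{ij}T^{[ij]}\,dV$$ holds for every moving region and every $t$. Then the total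 energy equation $$\rho\frac{dE}{dt}=\theta_{ij}T^{(ij)}+\omega_{ij}T^{[ij]}-\frac{\partial q^i}{\partial x^i}\qquad\text{everywhere on }D$$ is necessary and sufficient for the first law of thermodynamics $$\frac{d}{dt}\left[\mathcal K(t)+\mathcal E(t)\right]=\int_{\Sigma(t)}\rho\,\delta_{ij}u^iF^j\,dV+\oint_{\partial\Sigma(t)}\delta_{ij}u^is_{(n)}^j\,dS-\oint_{\partial\Sigma(t)}q^i\,dS_i$$ to hold for every moving region and every $t$ (the derivatives being part of the assertions). -/

import Mathlib

open Set MeasureTheory Topology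

noncomputable section

namespace Fluid

/-- Three-dimensional Euclidean space with its Cartesian coordinates `x 0, x 1, x 2`. -/
abbrev E3 := EuclideanSpace ℝ (Fin 3)

/-! ### The motion of a fluid -/

/-- A fluid motion `x = φ t ξ`: a one-parameter family of one-to-one maps, thrice continuously
differentiable in all variables, of the open region `U` filled by the fluid at time `0`,
with non-vanishing Jacobian. -/
structure Motion where
  /-- the region filled by the fluid at time `0` -/
  U : Set E3
  /-- `φ t ξ` is the position at time `t` of the particle which is at `ξ` at time `0` -/
  φ : ℝ → E3 → E3
  isOpen_U : IsOpen U
  contDiffOn_φ : ContDiffOn ℝ 3 (fun p : ℝ × E3 => φ p.1 p.2) (univ ×ˢ U)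
  injOn_φ : ∀ t, InjOn (φ t) U
  jacobian_ne_zero : ∀ t, ∀ ξ ∈ U, (fderiv ℝ (φ t) ξ).det ≠ 0
  φ_zero : ∀ ξ ∈ U, φ 0 ξ = ξ

namespace Motion

variable (M : Motion)

/-- The set of all `(t, x)` such that at time `t` the position `x` is occupied by the fluid. -/
def domain : Set (ℝ × E3) := {p | p.2 ∈ M.φ p.1 '' M.U}

/-- The inverse motion `ξ = ξ(x, t)`: the initial position of the particle which is
at `x` at time `t`. -/
def label (t : ℝ) (x : E3) : E3 := Function.invFunOn (M.φ t) M.U x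

/-- The fluid velocity field `u(x, t)`: the time derivative, at fixed `ξ`, of the position of the
particle which is at `x` at time `t`. -/
def velocity (t : ℝ) (x : E3) : E3 := deriv (fun s => M.φ s (M.label t x)) t

end Motion

/-! ### Derivatives and kinematic tensors -/

/-- The partial derivative `∂f/∂xʲ` at `x`. -/
def pderiv (j : Fin 3) (f : E3 → ℝ) (x : E3) : ℝ :=
  fderiv ℝ f x (EuclideanSpace.single j 1)

/-- The divergence `∂vⁱ/∂xⁱ`. -/
def divergence (v : E3 → E3) (x : E3) : ℝ := ∑ i, pderiv i (fun y => v y i) x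

namespace Motion

variable (M : Motion)

/-- The material derivative `df/dt = ∂f/∂t + uˡ ∂f/∂xˡ`. -/
def materialDeriv (f : ℝ → E3 → ℝ) (t : ℝ) (x : E3) : ℝ :=
  deriv (fun s => f s x) t + ∑ l, M.velocity t x l * pderiv l (f t) x

/-- The deformation tensor `θ_ij = (∂u_i/∂xʲ + ∂u_j/∂xⁱ) / 2`. -/
def deformation (t : ℝ) (x : E3) (i j : Fin 3) : ℝ :=
  (pderiv j (fun y => M.velocity t y i) x + pderiv i (fun y => M.velocity t y j) x) / 2

/-- The vorticity tensor `ω_ij = (∂u_i/∂xʲ - ∂u_j/∂xⁱ) / 2`. -/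
def vorticity (t : ℝ) (x : E3) (i j : Fin 3) : ℝ :=
  (pderiv j (fun y => M.velocity t y i) x - pderiv i (fun y => M.velocity t y j) x) / 2

end Motion

/-- The symmetric part `T^(ij)`. -/
def symPart (A : Matrix (Fin 3) (Fin 3) ℝ) (i j : Fin 3) : ℝ := (A i j + A j i) / 2

/-- The antisymmetric part `T^[ij]`. -/
def antisymPart (A : Matrix (Fin 3) (Fin 3) ℝ) (i j : Fin 3) : ℝ := (A i j - A j i) / 2

/-- `θ_ij T^(ij)`. -/
def Motion.deformationPower (M : Motion) (T : ℝ → E3 → Matrix (Fin 3) (Fin 3) ℝ)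
    (t : ℝ) (x : E3) : ℝ :=
  ∑ i, ∑ j, M.deformation t x i j * symPart (T t x) i j

/-- `ω_ij T^[ij]`. -/
def Motion.rotationPower (M : Motion) (T : ℝ → E3 → Matrix (Fin 3) (Fin 3) ℝ)
    (t : ℝ) (x : E3) : ℝ :=
  ∑ i, ∑ j, M.vorticity t x i j * antisymPart (T t x) i j

/-! ### Regions, outward normals and surface integrals -/

/-- `n` is the outward unit normal of `S` at the boundary point `x`: near `x`, the set `S` is
`{g ≤ 0}` for some continuously differentiable `g` with `g x = 0` and `∇g x ≠ 0`, and
`n = ∇g x / |∇g x|`. -/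
def IsOutwardNormal (S : Set E3) (x n : E3) : Prop :=
  ∃ g : E3 → ℝ, ContDiffAt ℝ 1 g x ∧ g x = 0 ∧ gradient g x ≠ 0 ∧
    (∀ᶠ y in 𝓝 x, y ∈ S ↔ g y ≤ 0) ∧ n = ‖gradient g x‖⁻¹ • gradient g x

open Classical in
/-- The outward unit normal of `S` at `x` where it exists (it is then unique), and `0` elsewhere. -/
def outwardNormal (S : Set E3) (x : E3) : E3 :=
  if h : ∃ n, IsOutwardNormal S x n then h.choose else 0

/-- A closed bounded region with piecewise smooth boundary: a compact set whose boundary has finite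
area and, except for a set of area zero (edges, vertices, ...), is a continuously differentiable
surface with the set on one side of it. `μHE[2]` is the surface area (the two-dimensional Hausdorff
measure, normalised so as to agree with area on planes). -/
structure IsRegion (S : Set E3) : Prop where
  isCompact : IsCompact S
  area_lt_top : μHE[2] (frontier S) < ⊤
  area_singular : μHE[2] {x ∈ frontier S | ¬ ∃ n, IsOutwardNormal S x n} = 0

/-- The surface integral `∮_{∂S} f(x, n) dS`, with `n` the outward unit normal. -/
def surfaceIntegral (S : Set E3) (f : E3 → E3 → ℝ) : ℝ :=
  ∫ x in frontier S, f x (outwardNormal S x) ∂μHE[2]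

/-- The stress vector `s_(n)ⁱ = Tⁱ_j nʲ`. -/
def stressVector (A : Matrix (Fin 3) (Fin 3) ℝ) (n : E3) (i : Fin 3) : ℝ := ∑ j, A i j * n j

namespace Motion

variable (M : Motion)

/-- The moving fluid region `Σ(t)` which occupies `S` at time `0`. -/
def moved (S : Set E3) (t : ℝ) : Set E3 := M.φ t '' S

/-! ### Integral quantities of a moving region `Σ(t)` and the balance laws -/

/-- The mass `∫_{Σ(t)} ρ dV`. -/
def mass (ρ : ℝ → E3 → ℝ) (S : Set E3) (t : ℝ) : ℝ := ∫ x in M.moved S t, ρ t x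

/-- The kinetic energy `½ ∫_{Σ(t)} ρ δ_ij uⁱ uʲ dV`. -/
def kineticEnergy (ρ : ℝ → E3 → ℝ) (S : Set E3) (t : ℝ) : ℝ :=
  1 / 2 * ∫ x in M.moved S t, ρ t x * ∑ i, M.velocity t x i * M.velocity t x i

/-- The internal energy `∫_{Σ(t)} ρ E dV`. -/
def internalEnergy (ρ E : ℝ → E3 → ℝ) (S : Set E3) (t : ℝ) : ℝ :=
  ∫ x in M.moved S t, ρ t x * E t x

/-- The rate of work of the external forces, `∫_{Σ(t)} ρ δ_ij uⁱ Fʲ dV`. -/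
def externalPower (ρ : ℝ → E3 → ℝ) (F : ℝ → E3 → E3) (S : Set E3) (t : ℝ) : ℝ :=
  ∫ x in M.moved S t, ρ t x * ∑ i, M.velocity t x i * F t x i

/-- The rate of work of the stress forces, `∮_{∂Σ(t)} δ_ij uⁱ s_(n)ʲ dS`. -/
def stressPower (T : ℝ → E3 → Matrix (Fin 3) (Fin 3) ℝ) (S : Set E3) (t : ℝ) : ℝ :=
  surfaceIntegral (M.moved S t)
    (fun x n => ∑ i, M.velocity t x i * stressVector (T t x) n i)

/-- The heat conducted out of the region per unit time, `∮_{∂Σ(t)} qⁱ dS_i`. -/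
def heatOutflow (q : ℝ → E3 → E3) (S : Set E3) (t : ℝ) : ℝ :=
  surfaceIntegral (M.moved S t) (fun x n => ∑ i, q t x i * n i)

/-- Conservation of mass: `d/dt ∫_{Σ(t)} ρ dV = 0` for every moving fluid region. -/
def ConservesMass (ρ : ℝ → E3 → ℝ) : Prop :=
  ∀ S, IsRegion S → S ⊆ M.U → ∀ t, HasDerivAt (M.mass ρ S) 0 t

/-- The kinetic energy transfer equation for every moving fluid region:
`dK/dt = ∫ ρ δ_ij uⁱ Fʲ dV + ∮ δ_ij uⁱ s_(n)ʲ dS - ∫ θ_ij T^(ij) dV - ∫ ω_ij T^[ij] dV`. -/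
def EnergyTransfer (ρ : ℝ → E3 → ℝ) (F : ℝ → E3 → E3)
    (T : ℝ → E3 → Matrix (Fin 3) (Fin 3) ℝ) : Prop :=
  ∀ S, IsRegion S → S ⊆ M.U → ∀ t,
    HasDerivAt (M.kineticEnergy ρ S)
      (M.externalPower ρ F S t + M.stressPower T S t
        - (∫ x in M.moved S t, M.deformationPower T t x)
        - (∫ x in M.moved S t, M.rotationPower T t x)) t

/-- The first law of thermodynamics for every moving fluid region:
`d/dt (K + ℰ) = ∫ ρ δ_ij uⁱ Fʲ dV + ∮ δ_ij uⁱ s_(n)ʲ dS - ∮ qⁱ dS_i`. -/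
def FirstLaw (ρ E : ℝ → E3 → ℝ) (F : ℝ → E3 → E3)
    (T : ℝ → E3 → Matrix (Fin 3) (Fin 3) ℝ) (q : ℝ → E3 → E3) : Prop :=
  ∀ S, IsRegion S → S ⊆ M.U → ∀ t,
    HasDerivAt (fun s => M.kineticEnergy ρ S s + M.internalEnergy ρ E S s)
      (M.externalPower ρ F S t + M.stressPower T S t - M.heatOutflow q S t) t

/-- The total energy equation `ρ dE/dt = θ_ij T^(ij) + ω_ij T^[ij] - ∂qⁱ/∂xⁱ`
at every time and every position occupied by the fluid. -/
def TotalEnergyEquation (ρ E : ℝ → E3 → ℝ)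
    (T : ℝ → E3 → Matrix (Fin 3) (Fin 3) ℝ) (q : ℝ → E3 → E3) : Prop :=
  ∀ t x, (t, x) ∈ M.domain →
    ρ t x * M.materialDeriv E t x
      = M.deformationPower T t x + M.rotationPower T t x - divergence (q t) x

end Motion

end Fluid

end

noncomputable section

/-! ### Local geometry at a regular boundary point, and integration along lines -/

namespace Fluid

open scoped RealInnerProductSpace

/-! Put `f = ρ dE/dt - θ_ij T^(ij) - ω_ij T^[ij] + ∂qⁱ/∂xⁱ`. The theorem comes down to one identity
for every moving region: the derivative of `K + ℰ` is the right-hand side of the first law plus the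
integral of `f` over `Σ(t)`. If `f = 0` the first law is immediate; conversely, uniqueness of
derivatives makes all these integrals vanish, and regions that start as balls suffice to force the
continuous function `f` to be zero.

The identity adds the kinetic energy transfer equation to the derivative of `ℰ`. In Lagrangian
coordinates mass conservation, tested on balls, says that density times Jacobian does not depend on
time (`ConservesMass.density_mul_jacobian`). Hence `ℰ` is an integral over a fixed set with a fixed
weight, only `E` is differentiated, and its derivative along particle paths is the material
derivative (`hasDerivAt_internalEnergy`). The heat flux becomes a volume integral by the divergence
theorem.

Most of the work is that divergence theorem (`IsRegion.setIntegral_divergence`), for Hausdorff area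
and a boundary that is `C¹` off a null set. Near a regular point with normal `n`, Fubini along lines
parallel to a direction `e` near `n` turns the integral of `∂φ/∂e` into the integral of `φ ≥ 0` over
the shadow of the boundary on the plane orthogonal to `e`. Projection does not increase area, which
bounds it above by the surface integral of `φ`; for `e = n` the projection is almost isometric,
which gives almost the same bound below. Comparing `n` with slightly tilted directions then controls
tangential derivatives (`IsOutwardNormal.exists_ball_estimate`). A partition of unity sums the local
errors, and they tend to zero. The singular set is removed by cutoffs whose gradients have small
`L¹` norm, available because a set of area zero is covered by balls with small sum of squared radii
(`exists_cutoff_of_area_eq_zero`). -/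

theorem IsOutwardNormal.norm_eq_one {S : Set E3} {x n : E3} (h : IsOutwardNormal S x n) :
    ‖n‖ = 1 := by
  obtain ⟨g, -, -, hg, -, rfl⟩ := h
  rw [norm_smul, norm_inv, norm_norm, inv_mul_cancel₀ (norm_ne_zero_iff.2 hg)]

/-- Near a frontier point with an outward normal `n`, differences of frontier points are almost
orthogonal to `n`, and `S` is a strict lower set in all directions close to `n`. -/
theorem IsOutwardNormal.exists_ball {S : Set E3} {x n : E3} (h : IsOutwardNormal S x n) {δ : ℝ}
    (hδ : 0 < δ) :
    ∃ r > 0, (∀ y ∈ frontier S ∩ Metric.ball x r, ∀ z ∈ frontier S ∩ Metric.ball x r,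
        |⟪n, y - z⟫| ≤ δ * ‖y - z‖) ∧
      ∀ y ∈ Metric.ball x r, ∀ z ∈ S ∩ Metric.ball x r,
        δ * ‖z - y‖ < ⟪n, z - y⟫ → y ∈ interior S := by
  obtain ⟨g, hg, hgx, hG, hS, rfl⟩ := h
  set G := gradient g x with hGdef
  have hGpos : 0 < ‖G‖ := norm_pos_iff.2 hG
  have hstrict : HasStrictFDerivAt g (fderiv ℝ g x) x := hg.hasStrictFDerivAt (by simp)
  have hfd : ∀ v, fderiv ℝ g x v = ⟪G, v⟫ := by
    intro v
    rw [hGdef, gradient, InnerProductSpace.toDual_symm_apply]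
  -- The tolerance carries the factor `‖G‖` because `n` is `G / ‖G‖`; dividing leaves exactly `δ`.
  have hev := hstrict.isLittleO.def (show 0 < δ * ‖G‖ by positivity)
  rw [nhds_prod_eq] at hev
  obtain ⟨p, hp, hpp⟩ := (Filter.eventually_prod_self_iff (r := fun y z =>
    ‖g y - g z - (fderiv ℝ g x) (y - z)‖ ≤ δ * ‖G‖ * ‖y - z‖)).1 hev
  replace hp : ∀ᶠ y in 𝓝 x, y ∈ p := hp
  have hcont : ∀ᶠ y in 𝓝 x, ContinuousAt g y :=
    (hg.eventually (by simp)).mono fun y hy => hy.continuousAt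
  obtain ⟨r, hr, hball⟩ := Metric.eventually_nhds_iff_ball.1 (((hp.and hS).and hcont))
  have hlt : ∀ y ∈ Metric.ball x r, g y < 0 → y ∈ interior S := by
    intro y hy hgy
    rw [mem_interior_iff_mem_nhds]
    filter_upwards [(hball y hy).2.eventually_lt continuousAt_const hgy,
      Metric.isOpen_ball.mem_nhds hy] with z hz hzb
    exact (hball z hzb).1.2.2 hz.le
  have hgt : ∀ y ∈ Metric.ball x r, 0 < g y → y ∉ closure S := by
    intro y hy hgy
    rw [mem_closure_iff_frequently, Filter.not_frequently]
    filter_upwards [continuousAt_const.eventually_lt (hball y hy).2 hgy,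
      Metric.isOpen_ball.mem_nhds hy] with z hz hzb hzS
    exact absurd ((hball z hzb).1.2.1 hzS) (not_le.2 hz)
  have hzero : ∀ y ∈ frontier S ∩ Metric.ball x r, g y = 0 := by
    rintro y ⟨hy, hyb⟩
    rcases lt_trichotomy (g y) 0 with h | h | h
    · exact absurd (hlt y hyb h) hy.2
    · exact h
    · exact absurd hy.1 (hgt y hyb h)
  refine ⟨r, hr, ?_, ?_⟩
  · intro y hy z hz
    have h1 := hpp y (hball y hy.2).1.1 z (hball z hz.2).1.1
    simp only [hzero y hy, hzero z hz, sub_self, zero_sub, norm_neg, hfd, Real.norm_eq_abs] at h1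
    rw [real_inner_smul_left, abs_mul, abs_inv, abs_norm, inv_mul_le_iff₀ hGpos]
    linarith
  · intro y hy z hz hyz
    have h1 := hpp z (hball z hz.2).1.1 y (hball y hy).1.1
    simp only [hfd, Real.norm_eq_abs] at h1
    rw [real_inner_smul_left, lt_inv_mul_iff₀ hGpos] at hyz
    have h2 := (abs_le.1 h1).1
    have h3 := (hball z hz.2).1.2.1 hz.1
    exact hlt y hy (by nlinarith)

/-- The integral over `S` of the derivative of `φ` along a line on which `S` is a lower set. -/
theorem integral_line_deriv {S B : Set E3} (hS : IsClosed S) (hBc : Convex ℝ B)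
    {e : E3} (hmono : ∀ y ∈ B, ∀ t : ℝ, 0 < t → y + t • e ∈ S ∩ B → y ∈ interior S)
    {φ : E3 → ℝ} (hφ : ContDiff ℝ 1 φ) (hc : HasCompactSupport φ) (hsub : tsupport φ ⊆ B)
    (he : e ≠ 0) (p : E3) :
    (∀ s : ℝ, p + s • e ∈ frontier S ∩ tsupport φ →
      ∫ t : ℝ, S.indicator (fun y => fderiv ℝ φ y e) (p + t • e) = φ (p + s • e)) ∧
    ((∀ s : ℝ, p + s • e ∉ frontier S ∩ tsupport φ) →
      ∫ t : ℝ, S.indicator (fun y => fderiv ℝ φ y e) (p + t • e) = 0) := by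
  classical
  set ψ : ℝ → ℝ := fun t => φ (p + t • e) with hψ
  have hline : ∀ t : ℝ, HasDerivAt (fun t : ℝ => p + t • e) e t := fun t => by
    simpa using ((hasDerivAt_id t).smul_const e).const_add p
  have hder : ∀ t, HasDerivAt ψ (fderiv ℝ φ (p + t • e) e) t := fun t =>
    ((hφ.differentiable one_ne_zero _).hasFDerivAt).comp_hasDerivAt t (hline t)
  have hclosed : IsClosedEmbedding (fun t : ℝ => p + t • e) :=
    (Homeomorph.addLeft p).isClosedEmbedding.comp (isClosedEmbedding_smul_left he)
  have hψc : HasCompactSupport ψ := hc.comp_isClosedEmbedding hclosed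
  have hψ1 : ContDiff ℝ 1 ψ := hφ.comp (contDiff_const.add (contDiff_id.smul contDiff_const))
  have hzero : ∀ y ∉ B, φ y = 0 ∧ fderiv ℝ φ y = 0 := fun y hy =>
    ⟨image_eq_zero_of_notMem_tsupport fun h => hy (hsub h),
      image_eq_zero_of_notMem_tsupport fun h => hy (hsub (tsupport_fderiv_subset ℝ h))⟩
  have hfr : frontier S ⊆ S := hS.frontier_subset
  -- Inside `B` the line meets `S` exactly in the half-line ending at `s`, and outside `B` the
  -- derivative vanishes, so the fundamental theorem of calculus applies.
  have key : ∀ s : ℝ, p + s • e ∈ frontier S ∩ B →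
      ∫ t : ℝ, S.indicator (fun y => fderiv ℝ φ y e) (p + t • e) = φ (p + s • e) := by
    rintro s ⟨hs, hsB⟩
    have h1 : (fun t : ℝ => S.indicator (fun y => fderiv ℝ φ y e) (p + t • e))
        = (Iic s).indicator (deriv ψ) := by
      funext t
      by_cases htB : p + t • e ∈ B
      · rcases le_or_gt t s with hts | hts
        · have : p + t • e ∈ S := by
            rcases hts.eq_or_lt with rfl | hts
            · exact hfr hs
            · apply interior_subset
              refine hmono _ htB (s - t) (sub_pos.2 hts) ?_
              rw [add_assoc, ← add_smul, add_sub_cancel]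
              exact ⟨hfr hs, hsB⟩
          rw [indicator_of_mem this, indicator_of_mem (show t ∈ Iic s from hts), (hder t).deriv]
        · have : p + t • e ∉ S := by
            intro hmem
            refine hs.2 (hmono _ hsB (t - s) (sub_pos.2 hts) ?_)
            rw [add_assoc, ← add_smul, add_sub_cancel]
            exact ⟨hmem, htB⟩
          rw [indicator_of_notMem this, indicator_of_notMem (by simpa using hts)]
      · have h0 : fderiv ℝ φ (p + t • e) e = 0 := by rw [(hzero _ htB).2]; rfl
        rw [indicator_apply, indicator_apply, (hder t).deriv, h0]
        simp
    rw [h1, integral_indicator measurableSet_Iic, hψc.integral_Iic_deriv_eq hψ1]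
  refine ⟨fun s hs => key s ⟨hs.1, hsub hs.2⟩, fun hno => ?_⟩
  by_cases hex : ∃ s : ℝ, p + s • e ∈ frontier S ∩ B
  · obtain ⟨s, hs⟩ := hex
    rw [key s hs]
    exact image_eq_zero_of_notMem_tsupport fun h => hno s ⟨hs.1, h⟩
  · push Not at hex
    -- With no frontier point on the line inside `B`, connectedness of `J` puts this piece of line
    -- wholly inside or wholly outside `S`; the integral is zero either way.
    set J : Set ℝ := (fun t : ℝ => p + t • e) ⁻¹' B with hJ
    have hJc : IsPreconnected J := by
      apply Convex.isPreconnected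
      have := hBc.affine_preimage (AffineMap.lineMap (k := ℝ) p (p + e))
      convert! this using 1
      ext t
      simp [hJ, AffineMap.lineMap_apply, add_comm]
    by_cases hne : ∃ t ∈ J, p + t • e ∈ S
    · obtain ⟨t₁, ht₁, ht₁S⟩ := hne
      have hall : ∀ t ∈ J, p + t • e ∈ S := by
        have hsub' : J ⊆ (fun t : ℝ => p + t • e) ⁻¹' interior S := by
          apply hJc.subset_of_closure_inter_subset
          · exact isOpen_interior.preimage hclosed.continuous
          · refine ⟨t₁, ht₁, ?_⟩
            by_contra hcon
            exact hex t₁ ⟨⟨subset_closure ht₁S, hcon⟩, ht₁⟩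
          · rintro t ⟨ht, htJ⟩
            have h2 : p + t • e ∈ closure (interior S) :=
              closure_minimal (s := (fun t : ℝ => p + t • e) ⁻¹' interior S)
                (t := (fun t : ℝ => p + t • e) ⁻¹' closure (interior S))
                (preimage_mono subset_closure)
                (isClosed_closure.preimage hclosed.continuous) ht
            by_contra hcon
            exact hex t ⟨⟨closure_mono interior_subset h2, hcon⟩, htJ⟩
        exact fun t ht => interior_subset (hsub' ht)
      have h1 : (fun t : ℝ => S.indicator (fun y => fderiv ℝ φ y e) (p + t • e)) = deriv ψ := by
        funext t
        by_cases htB : p + t • e ∈ B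
        · rw [indicator_of_mem (hall t htB), (hder t).deriv]
        · have h0 : fderiv ℝ φ (p + t • e) e = 0 := by rw [(hzero _ htB).2]; rfl
          rw [indicator_apply, (hder t).deriv, h0]
          simp
      rw [h1]
      exact integral_eq_zero_of_hasDerivAt_of_integrable (fun t => (hψ1.differentiable one_ne_zero t).hasDerivAt)
        ((hψ1.continuous_deriv le_rfl).integrable_of_hasCompactSupport hψc.deriv)
        (hψ1.continuous.integrable_of_hasCompactSupport hψc)
    · push Not at hne
      have h1 : (fun t : ℝ => S.indicator (fun y => fderiv ℝ φ y e) (p + t • e)) = 0 := by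
        funext t
        by_cases htB : p + t • e ∈ B
        · rw [indicator_of_notMem (hne t htB)]; rfl
        · have h0 : fderiv ℝ φ (p + t • e) e = 0 := by rw [(hzero _ htB).2]; rfl
          rw [indicator_apply, h0]
          simp
      rw [h1]; simp

/-- The orthogonal decomposition is an isometry, and a unit vector identifies its span isometrically
with `ℝ`. This is the change of variables for Fubini along `e`. -/
theorem measurePreserving_orthogonal_add_smul {e : E3} (he : ‖e‖ = 1) :
    MeasurePreserving (fun x : (ℝ ∙ e)ᗮ × ℝ => (x.1 : E3) + x.2 • e) (volume.prod volume) volume := by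
  have h1 : MeasurePreserving (fun x : (ℝ ∙ e) × (ℝ ∙ e)ᗮ => (x.1 : E3) + x.2) := by
    have := (WithLp.volume_preserving_toLp (ℝ ∙ e) (ℝ ∙ e)ᗮ)
    have h2 := ((ℝ ∙ e).orthogonalDecomposition.symm.measurePreserving).comp this
    convert! h2 using 1
  have h3 : MeasurePreserving (fun x : (ℝ ∙ e)ᗮ × ℝ =>
      (LinearIsometryEquiv.toSpanUnitSingleton e he x.2, x.1)) (volume.prod volume)
        (volume.prod volume) := by
    have h4 := ((LinearIsometryEquiv.toSpanUnitSingleton e he).measurePreserving.prod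
      (MeasurePreserving.id (volume : Measure (ℝ ∙ e)ᗮ)))
    exact h4.comp Measure.measurePreserving_swap
  convert! h1.comp h3 using 1
  funext x
  simp [add_comm]

end Fluid

/-! ### Area and orthogonal projection -/

namespace Fluid

open scoped RealInnerProductSpace NNReal ENNReal

theorem _root_.LipschitzOnWith.euclideanHausdorffMeasure_image_le {X Y : Type*}
    [EMetricSpace X] [MeasurableSpace X] [BorelSpace X] [EMetricSpace Y] [MeasurableSpace Y]
    [BorelSpace Y] {K : ℝ≥0} {f : X → Y} {s : Set X} (h : LipschitzOnWith K f s) (d : ℕ) :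
    μHE[d] (f '' s) ≤ (K : ℝ≥0∞) ^ d * μHE[d] s := by
  have := h.hausdorffMeasure_image_le (d := d) (by positivity)
  rw [ENNReal.rpow_natCast] at this
  simp only [Measure.euclideanHausdorffMeasure_def, Measure.smul_apply, ENNReal.smul_def,
    smul_eq_mul]
  rw [mul_left_comm]
  gcongr

theorem finrank_orthogonal_span_singleton_E3 {e : E3} (he : ‖e‖ = 1) :
    Module.finrank ℝ (ℝ ∙ e)ᗮ = 2 := by
  have : Fact (Module.finrank ℝ E3 = 2 + 1) := ⟨by simp⟩
  exact Submodule.finrank_orthogonal_span_singleton (by rintro rfl; simp at he)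

theorem volume_orthogonal_eq {e : E3} (he : ‖e‖ = 1) :
    (volume : Measure (ℝ ∙ e)ᗮ) = μHE[2] := by
  rw [← InnerProductSpace.euclideanHausdorffMeasure_eq_volume,
    finrank_orthogonal_span_singleton_E3 he]

theorem exists_eq_projection_add (e : E3) (y : E3) :
    ∃ s : ℝ, y = ((ℝ ∙ e)ᗮ.orthogonalProjectionOnto y : E3) + s • e := by
  have h := (ℝ ∙ e).starProjection_add_starProjection_orthogonal y
  obtain ⟨s, hs⟩ := Submodule.mem_span_singleton.1 ((ℝ ∙ e).starProjection_apply_mem y)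
  refine ⟨s, ?_⟩
  rw [hs, add_comm]
  exact h.symm

theorem projection_add (e : E3) (p : (ℝ ∙ e)ᗮ) (s : ℝ) :
    (ℝ ∙ e)ᗮ.orthogonalProjectionOnto ((p : E3) + s • e) = p := by
  rw [map_add, map_smul, Submodule.orthogonalProjectionOnto_mem_subspace_eq_self,
    Submodule.orthogonalProjectionOnto_orthogonal_apply_eq_zero (Submodule.mem_span_singleton_self e)]
  simp

variable {S B : Set E3} {e : E3} {φ : E3 → ℝ}

/-- Of two frontier points on one line parallel to `e`, the one further back would be interior by
`hmono`. -/
theorem injOn_projection (hmono : ∀ y ∈ B, ∀ t : ℝ, 0 < t → y + t • e ∈ S ∩ B → y ∈ interior S)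
    (hS : IsClosed S) (hsub : tsupport φ ⊆ B) :
    InjOn (ℝ ∙ e)ᗮ.orthogonalProjectionOnto (frontier S ∩ tsupport φ) := by
  intro y hy z hz hyz
  obtain ⟨s, hs⟩ := exists_eq_projection_add e y
  obtain ⟨t, ht⟩ := exists_eq_projection_add e z
  rcases lt_trichotomy s t with h | h | h
  · refine absurd (hmono y (hsub hy.2) (t - s) (sub_pos.2 h) ?_) hy.1.2
    have : y + (t - s) • e = z := by
      rw [hs, hyz, add_assoc, ← add_smul, add_sub_cancel, ← ht]
    rw [this]
    exact ⟨hS.frontier_subset hz.1, hsub hz.2⟩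
  · rw [hs, ht, hyz, h]
  · refine absurd (hmono z (hsub hz.2) (s - t) (sub_pos.2 h) ?_) hz.1.2
    have : z + (s - t) • e = y := by
      rw [ht, ← hyz, add_assoc, ← add_smul, add_sub_cancel, ← hs]
    rw [this]
    exact ⟨hS.frontier_subset hy.1, hsub hy.2⟩

/-- The integral of `∂φ/∂e` over `S` as an integral over the shadow of the frontier of `S` in the
plane orthogonal to `e`. -/
theorem ofReal_setIntegral_fderiv_eq (hS : IsClosed S) (hBc : Convex ℝ B)
    (hmono : ∀ y ∈ B, ∀ t : ℝ, 0 < t → y + t • e ∈ S ∩ B → y ∈ interior S)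
    (hφ : ContDiff ℝ 1 φ) (hc : HasCompactSupport φ) (hsub : tsupport φ ⊆ B) (he : ‖e‖ = 1)
    (hpos : ∀ y, 0 ≤ φ y) :
    0 ≤ ∫ y in S, fderiv ℝ φ y e ∧
    ENNReal.ofReal (∫ y in S, fderiv ℝ φ y e) =
      ∫⁻ p in (ℝ ∙ e)ᗮ.orthogonalProjectionOnto '' (frontier S ∩ tsupport φ),
        ENNReal.ofReal (φ (Function.invFunOn (ℝ ∙ e)ᗮ.orthogonalProjectionOnto
          (frontier S ∩ tsupport φ) p)) := by
  set A := frontier S ∩ tsupport φ with hA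
  set P := (ℝ ∙ e)ᗮ.orthogonalProjectionOnto with hP
  set σ := Function.invFunOn P A with hσ
  have hAc : IsCompact A := hc.isCompact.inter_left isClosed_frontier
  have hinj : InjOn P A := injOn_projection hmono hS hsub
  have hPA : MeasurableSet (P '' A) := (hAc.image P.continuous).measurableSet
  have he0 : e ≠ 0 := by rintro rfl; simp at he
  have hint : Integrable (S.indicator (fun y => fderiv ℝ φ y e)) volume := by
    refine Integrable.indicator ?_ hS.measurableSet
    refine Continuous.integrable_of_hasCompactSupport ?_ (hc.fderiv_apply ℝ e)
    exact (hφ.continuous_fderiv one_ne_zero).clm_apply continuous_const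
  have hmp := measurePreserving_orthogonal_add_smul he
  have hint2 : Integrable (fun x : (ℝ ∙ e)ᗮ × ℝ =>
      S.indicator (fun y => fderiv ℝ φ y e) ((x.1 : E3) + x.2 • e)) (volume.prod volume) :=
    hmp.integrable_comp_of_integrable hint
  have hinner : ∀ p : (ℝ ∙ e)ᗮ, ∫ t : ℝ, S.indicator (fun y => fderiv ℝ φ y e) ((p : E3) + t • e)
      = (P '' A).indicator (fun p => φ (σ p)) p := by
    intro p
    obtain ⟨h1, h2⟩ := integral_line_deriv hS hBc hmono hφ hc hsub he0 (p : E3)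
    by_cases hp : p ∈ P '' A
    · rw [indicator_of_mem hp]
      obtain ⟨y, hy, rfl⟩ := hp
      obtain ⟨s, hs⟩ := exists_eq_projection_add e y
      rw [h1 s (hs ▸ hy), ← hs, hσ, hinj.leftInvOn_invFunOn hy]
    · rw [indicator_of_notMem hp]
      refine h2 fun s hs => hp ⟨_, hs, projection_add e p s⟩
  have hmain : ∫ y in S, fderiv ℝ φ y e = ∫ p, (P '' A).indicator (fun p => φ (σ p)) p := by
    rw [← integral_indicator hS.measurableSet, ← hmp.map_eq,
      integral_map hmp.measurable.aemeasurable (by rw [hmp.map_eq]; exact hint.1),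
      integral_prod _ hint2]
    simp_rw [hinner]
  have hint3 : Integrable ((P '' A).indicator (fun p => φ (σ p))) := by
    have := hint2.integral_prod_left
    simp only [hinner] at this
    exact this
  have hnn : 0 ≤ (P '' A).indicator (fun p => φ (σ p)) := indicator_nonneg fun p _ => hpos _
  refine ⟨hmain ▸ integral_nonneg hnn, ?_⟩
  rw [hmain, ofReal_integral_eq_lintegral_ofReal hint3 (ae_of_all _ hnn),
    ← lintegral_indicator hPA]
  congr 1
  funext p
  by_cases hp : p ∈ P '' A
  · simp [indicator_of_mem hp]
  · simp [indicator_of_notMem hp]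

/-- Orthogonal projection is 1-Lipschitz, so it does not increase two-dimensional Hausdorff measure,
which is the volume on the plane. -/
theorem setLIntegral_projection_le {A : Set E3} (hA : IsCompact A) (he : ‖e‖ = 1)
    (hinj : InjOn (ℝ ∙ e)ᗮ.orthogonalProjectionOnto A) (f : E3 → ℝ≥0∞) :
    ∫⁻ p in (ℝ ∙ e)ᗮ.orthogonalProjectionOnto '' A,
        f (Function.invFunOn (ℝ ∙ e)ᗮ.orthogonalProjectionOnto A p) ≤
      ∫⁻ y in A, f y ∂μHE[2] := by
  set P := (ℝ ∙ e)ᗮ.orthogonalProjectionOnto with hP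
  set σ := Function.invFunOn P A with hσ
  have hle : (volume : Measure (ℝ ∙ e)ᗮ).restrict (P '' A) ≤
      ((μHE[2] : Measure E3).restrict A).map P := by
    refine Measure.le_iff.2 fun C hC => ?_
    rw [Measure.map_apply P.continuous.measurable hC, Measure.restrict_apply hC,
      Measure.restrict_apply (P.continuous.measurable hC), volume_orthogonal_eq he]
    have h1 : C ∩ P '' A = P '' (P ⁻¹' C ∩ A) := by
      rw [inter_comm, inter_comm _ A, image_inter_preimage]
    rw [h1]
    have h2 : LipschitzOnWith 1 P (P ⁻¹' C ∩ A) :=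
      ((Submodule.lipschitzWith_orthogonalProjectionOnto (ℝ ∙ e)ᗮ)).lipschitzOnWith
    simpa using h2.euclideanHausdorffMeasure_image_le 2
  calc _ ≤ ∫⁻ p, f (σ p) ∂(((μHE[2] : Measure E3).restrict A).map P) := lintegral_mono' hle le_rfl
    _ ≤ ∫⁻ y in A, f (σ (P y)) ∂μHE[2] := lintegral_map_le _ _
    _ = ∫⁻ y in A, f y ∂μHE[2] := by
      refine setLIntegral_congr_fun hA.measurableSet fun y hy => ?_
      simp only [hσ, hinj.leftInvOn_invFunOn hy]

/-- The inverse of the projection is `C`-Lipschitz on the shadow of `A`, so it enlarges area by at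
most `C ^ 2`. -/
theorem setLIntegral_le_projection {A : Set E3} (hA : IsCompact A) (he : ‖e‖ = 1) {C : ℝ≥0}
    (hlip : ∀ y ∈ A, ∀ z ∈ A, dist y z ≤ C * dist ((ℝ ∙ e)ᗮ.orthogonalProjectionOnto y)
      ((ℝ ∙ e)ᗮ.orthogonalProjectionOnto z)) {f : E3 → ℝ≥0∞} (hf : Continuous f) :
    ∫⁻ y in A, f y ∂μHE[2] ≤ (C : ℝ≥0∞) ^ 2 *
      ∫⁻ p in (ℝ ∙ e)ᗮ.orthogonalProjectionOnto '' A,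
        f (Function.invFunOn (ℝ ∙ e)ᗮ.orthogonalProjectionOnto A p) := by
  classical
  set P := (ℝ ∙ e)ᗮ.orthogonalProjectionOnto with hP
  set σ := Function.invFunOn P A with hσ
  have hinj : InjOn P A := fun y hy z hz hyz => by
    have := hlip y hy z hz
    rw [hyz, dist_self, mul_zero] at this
    exact dist_le_zero.1 this
  have hleft : ∀ y ∈ A, σ (P y) = y := fun y hy => hinj.leftInvOn_invFunOn hy
  have hσlip : LipschitzOnWith C σ (P '' A) := by
    refine LipschitzOnWith.of_dist_le_mul ?_
    rintro _ ⟨y, hy, rfl⟩ _ ⟨z, hz, rfl⟩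
    rw [hleft y hy, hleft z hz]
    exact hlip y hy z hz
  have hPA : MeasurableSet (P '' A) := (hA.image P.continuous).measurableSet
  -- The section `σ` is controlled only on the shadow; extension by zero gives a measurable function
  -- on the whole plane.
  set g : (ℝ ∙ e)ᗮ → ℝ≥0∞ := (P '' A).piecewise (fun p => f (σ p)) 0 with hg
  have hgm : Measurable g :=
    (hf.comp_continuousOn hσlip.continuousOn).measurable_piecewise continuousOn_const hPA
  have hle : ((μHE[2] : Measure E3).restrict A).map P ≤
      ((C : ℝ≥0∞) ^ 2) • (volume : Measure (ℝ ∙ e)ᗮ).restrict (P '' A) := by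
    refine Measure.le_iff.2 fun D hD => ?_
    rw [Measure.map_apply P.continuous.measurable hD, Measure.smul_apply,
      Measure.restrict_apply hD,
      Measure.restrict_apply (P.continuous.measurable hD), volume_orthogonal_eq he, smul_eq_mul]
    have h1 : P ⁻¹' D ∩ A = σ '' (D ∩ P '' A) := by
      ext y
      constructor
      · rintro ⟨h, hy⟩
        exact ⟨P y, ⟨h, y, hy, rfl⟩, hleft y hy⟩
      · rintro ⟨_, ⟨h, z, hz, rfl⟩, rfl⟩
        rw [hleft z hz]
        exact ⟨h, hz⟩
    rw [h1]
    exact (hσlip.mono inter_subset_right).euclideanHausdorffMeasure_image_le 2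
  calc ∫⁻ y in A, f y ∂μHE[2] = ∫⁻ y in A, g (P y) ∂μHE[2] := by
        refine setLIntegral_congr_fun hA.measurableSet fun y hy => ?_
        simp only [hg, piecewise_eq_of_mem _ _ _ (mem_image_of_mem P hy), hleft y hy]
    _ = ∫⁻ p, g p ∂(((μHE[2] : Measure E3).restrict A).map P) :=
        (lintegral_map hgm P.continuous.measurable).symm
    _ ≤ ∫⁻ p, g p ∂(((C : ℝ≥0∞) ^ 2) • (volume : Measure (ℝ ∙ e)ᗮ).restrict (P '' A)) :=
        lintegral_mono' hle le_rfl
    _ = _ := by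
        rw [lintegral_smul_measure, smul_eq_mul]
        congr 1
        refine setLIntegral_congr_fun hPA fun p hp => ?_
        simp only [hg, piecewise_eq_of_mem _ _ _ hp]

end Fluid

/-! ### The Gauss formula near a regular boundary point, up to a small error -/

namespace Fluid

open scoped RealInnerProductSpace NNReal ENNReal

variable {S B : Set E3} {x n e : E3} {φ : E3 → ℝ}

theorem norm_sq_eq_projection_add (he : ‖e‖ = 1) (v : E3) :
    ‖v‖ ^ 2 = ‖(ℝ ∙ e)ᗮ.orthogonalProjectionOnto v‖ ^ 2 + ⟪e, v⟫ ^ 2 := by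
  obtain ⟨s, hs⟩ := exists_eq_projection_add e v
  set p := (ℝ ∙ e)ᗮ.orthogonalProjectionOnto v with hp
  have h1 : ⟪e, (p : E3)⟫ = 0 := Submodule.mem_orthogonal_singleton_iff_inner_right.1 p.2
  have h2 : ⟪(p : E3), e⟫ = 0 := Submodule.mem_orthogonal_singleton_iff_inner_left.1 p.2
  have h3 : ⟪e, v⟫ = s := by
    rw [hs, inner_add_right, h1, inner_smul_right, real_inner_self_eq_norm_sq, he]; ring
  rw [h3]
  conv_lhs => rw [hs]
  rw [norm_add_sq_real, inner_smul_right, h2, norm_smul, he, Real.norm_eq_abs, mul_one, sq_abs]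
  simp

/-- By Pythagoras, a chord whose component along `e` is at most `δ` times its length keeps at least
the fraction `√(1 - δ ^ 2)` of that length under projection. -/
theorem dist_le_projection (he : ‖e‖ = 1) {δ : ℝ} (hδ1 : δ < 1) {y z : E3}
    (h : |⟪e, y - z⟫| ≤ δ * ‖y - z‖) :
    dist y z ≤ Real.toNNReal (√(1 - δ ^ 2))⁻¹ * dist ((ℝ ∙ e)ᗮ.orthogonalProjectionOnto y)
      ((ℝ ∙ e)ᗮ.orthogonalProjectionOnto z) := by
  rcases eq_or_ne y z with rfl | hne
  · simp
  have hpos : 0 < ‖y - z‖ := norm_pos_iff.2 (sub_ne_zero.2 hne)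
  have hδ0 : 0 ≤ δ := nonneg_of_mul_nonneg_left ((abs_nonneg _).trans h) hpos
  have h1 : 0 < 1 - δ ^ 2 := by nlinarith
  rw [dist_eq_norm, dist_eq_norm, ← map_sub, Real.coe_toNNReal _ (by positivity),
    le_inv_mul_iff₀ (Real.sqrt_pos.2 h1)]
  refine abs_le_of_sq_le_sq' ?_ (norm_nonneg _) |>.2
  rw [mul_pow, Real.sq_sqrt h1.le]
  have h2 := norm_sq_eq_projection_add he (y - z)
  have h3 : ⟪e, y - z⟫ ^ 2 ≤ (δ * ‖y - z‖) ^ 2 := sq_le_sq' (abs_le.1 h).1 (abs_le.1 h).2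
  nlinarith

theorem integrableOn_frontier_and_ofReal_setIntegral_eq (harea : μHE[2] (frontier S) < ⊤)
    (hφ : Continuous φ) (hc : HasCompactSupport φ) (hpos : ∀ y, 0 ≤ φ y) :
    IntegrableOn φ (frontier S) μHE[2] ∧ ENNReal.ofReal (∫ y in frontier S, φ y ∂μHE[2]) =
      ∫⁻ y in frontier S ∩ tsupport φ, ENNReal.ofReal (φ y) ∂μHE[2] := by
  have hint : IntegrableOn φ (frontier S) μHE[2] := by
    obtain ⟨C, hC⟩ := hφ.bounded_above_of_compact_support hc
    exact Measure.integrableOn_of_bounded harea.ne hφ.aestronglyMeasurable (ae_of_all _ hC)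
  refine ⟨hint, ?_⟩
  rw [ofReal_integral_eq_lintegral_ofReal hint (ae_of_all _ hpos)]
  rw [inter_comm, ← Measure.restrict_restrict (isClosed_tsupport φ).measurableSet]
  symm
  apply setLIntegral_eq_of_support_subset
  intro y hy
  apply subset_tsupport φ
  intro h0
  simp [h0] at hy

theorem setIntegral_fderiv_le (hS : IsClosed S) (harea : μHE[2] (frontier S) < ⊤)
    (hBc : Convex ℝ B)
    (hmono : ∀ y ∈ B, ∀ t : ℝ, 0 < t → y + t • e ∈ S ∩ B → y ∈ interior S)
    (hφ : ContDiff ℝ 1 φ) (hc : HasCompactSupport φ) (hsub : tsupport φ ⊆ B) (he : ‖e‖ = 1)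
    (hpos : ∀ y, 0 ≤ φ y) :
    ∫ y in S, fderiv ℝ φ y e ≤ ∫ y in frontier S, φ y ∂μHE[2] := by
  obtain ⟨h0, h1⟩ := ofReal_setIntegral_fderiv_eq hS hBc hmono hφ hc hsub he hpos
  obtain ⟨-, h2⟩ := integrableOn_frontier_and_ofReal_setIntegral_eq harea hφ.continuous hc hpos
  rw [← ENNReal.ofReal_le_ofReal_iff (integral_nonneg hpos), h1, h2]
  exact setLIntegral_projection_le (hc.isCompact.inter_left isClosed_frontier) he
    (injOn_projection hmono hS hsub) fun y => ENNReal.ofReal (φ y)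

/-- The reverse of `setIntegral_fderiv_le`: flatness bounds the inverse projection, and its
Lipschitz constant enters squared. Finite area is not assumed, so the bound can also be used to
prove it. -/
theorem setLIntegral_le_setIntegral_fderiv (hS : IsClosed S)
    (hBc : Convex ℝ B)
    (hmono : ∀ y ∈ B, ∀ t : ℝ, 0 < t → y + t • e ∈ S ∩ B → y ∈ interior S)
    {δ : ℝ} (hδ0 : 0 ≤ δ) (hδ1 : δ < 1)
    (hflat : ∀ y ∈ frontier S ∩ B, ∀ z ∈ frontier S ∩ B, |⟪e, y - z⟫| ≤ δ * ‖y - z‖)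
    (hφ : ContDiff ℝ 1 φ) (hc : HasCompactSupport φ) (hsub : tsupport φ ⊆ B) (he : ‖e‖ = 1)
    (hpos : ∀ y, 0 ≤ φ y) :
    ∫⁻ y in frontier S ∩ tsupport φ, ENNReal.ofReal (φ y) ∂μHE[2] ≤
      ENNReal.ofReal ((1 - δ ^ 2)⁻¹ * ∫ y in S, fderiv ℝ φ y e) := by
  obtain ⟨h0, h1⟩ := ofReal_setIntegral_fderiv_eq hS hBc hmono hφ hc hsub he hpos
  have hpos' : 0 < 1 - δ ^ 2 := by nlinarith
  rw [ENNReal.ofReal_mul (by positivity), h1]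
  have h2 := setLIntegral_le_projection (hc.isCompact.inter_left isClosed_frontier) he
    (fun y hy z hz => dist_le_projection he hδ1
      (hflat y ⟨hy.1, hsub hy.2⟩ z ⟨hz.1, hsub hz.2⟩))
    (f := fun y => ENNReal.ofReal (φ y)) (ENNReal.continuous_ofReal.comp hφ.continuous)
  refine h2.trans (le_of_eq ?_)
  congr 1
  change (ENNReal.ofReal _) ^ 2 = _
  rw [← ENNReal.ofReal_pow (by positivity), inv_pow, Real.sq_sqrt hpos'.le]

/-- One radius serves all directions `e` in the cone, so `e` may be tilted later without shrinking
the ball. -/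
theorem IsOutwardNormal.exists_ball_mono (h : IsOutwardNormal S x n) {δ : ℝ} (hδ : 0 < δ) :
    ∃ r > 0, (∀ y ∈ frontier S ∩ Metric.ball x r, ∀ z ∈ frontier S ∩ Metric.ball x r,
        |⟪n, y - z⟫| ≤ δ * ‖y - z‖) ∧
      ∀ e : E3, ‖e‖ = 1 → δ < ⟪n, e⟫ → ∀ y ∈ Metric.ball x r, ∀ t : ℝ, 0 < t →
        y + t • e ∈ S ∩ Metric.ball x r → y ∈ interior S := by
  obtain ⟨r, hr, h1, h2⟩ := h.exists_ball hδ
  refine ⟨r, hr, h1, fun e he hne y hy t ht hyt => h2 y hy _ hyt ?_⟩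
  rw [add_sub_cancel_left, norm_smul, inner_smul_right, he, Real.norm_eq_abs, abs_of_pos ht]
  nlinarith

/-- A bump function equal to one near `x` dominates the area there, and its surface integral is
bounded by a finite volume integral. -/
theorem IsOutwardNormal.exists_area_lt_top (hS : IsClosed S) (h : IsOutwardNormal S x n) :
    ∃ r > 0, μHE[2] (frontier S ∩ Metric.ball x r) < ⊤ := by
  obtain ⟨r, hr, h1, h2⟩ := h.exists_ball_mono (δ := 1 / 2) (by norm_num)
  have hn := h.norm_eq_one
  let f : ContDiffBump x := ⟨r / 4, r / 2, by positivity, by linarith⟩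
  have hsub : tsupport f ⊆ Metric.ball x r := by
    rw [f.tsupport_eq]
    exact Metric.closedBall_subset_ball (by change r / 2 < r; linarith)
  have h3 := setLIntegral_le_setIntegral_fderiv hS (convex_ball x r)
    (h2 n hn (by rw [real_inner_self_eq_norm_sq, hn]; norm_num)) (by norm_num) (by norm_num) h1
    f.contDiff f.hasCompactSupport hsub hn (fun y => f.nonneg)
  refine ⟨r / 4, by positivity, lt_of_le_of_lt ?_ (h3.trans_lt ENNReal.ofReal_lt_top)⟩
  have hone : ∀ y ∈ Metric.ball x (r / 4), f y = 1 := fun y hy =>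
    f.one_of_mem_closedBall (Metric.ball_subset_closedBall hy)
  calc μHE[2] (frontier S ∩ Metric.ball x (r / 4))
      = ∫⁻ y in frontier S ∩ Metric.ball x (r / 4), ENNReal.ofReal (f y) ∂μHE[2] := by
        rw [← setLIntegral_one]
        refine setLIntegral_congr_fun
          (isClosed_frontier.measurableSet.inter Metric.isOpen_ball.measurableSet) fun y hy => ?_
        simp [hone y hy.2]
    _ ≤ ∫⁻ y in frontier S ∩ tsupport f, ENNReal.ofReal (f y) ∂μHE[2] :=
      lintegral_mono_set fun y hy => ⟨hy.1, subset_tsupport f (by simp [hone y hy.2])⟩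

/-- A tilt of size `c` lengthens the unit vector only to second order in `c`; this gain drives the
estimate of tangential derivatives. -/
theorem add_smul_orthogonal_bounds {n w : E3} (hn : ‖n‖ = 1) (hw : ‖w‖ = 1) (hnw : ⟪n, w⟫ = 0)
    {c : ℝ} (hc : |c| ≤ 1) :
    ‖n + c • w‖ ≤ 1 + c ^ 2 / 2 ∧ 0 < ‖n + c • w‖ ∧
      1 / 2 < ⟪n, ‖n + c • w‖⁻¹ • (n + c • w)⟫ := by
  have h1 : ‖n + c • w‖ ^ 2 = 1 + c ^ 2 := by
    rw [norm_add_sq_real, inner_smul_right, hnw, norm_smul, hn, hw, Real.norm_eq_abs, mul_one,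
      sq_abs]; ring
  have hc2 : c ^ 2 ≤ 1 := by rw [← sq_abs]; nlinarith [abs_nonneg c]
  have h0 := norm_nonneg (n + c • w)
  have hle : ‖n + c • w‖ ≤ 1 + c ^ 2 / 2 := by nlinarith [sq_nonneg (c ^ 2), sq_nonneg c]
  have hpos : 0 < ‖n + c • w‖ := by
    rcases h0.eq_or_lt with h | h
    · rw [← h] at h1; nlinarith [sq_nonneg c]
    · exact h
  refine ⟨hle, hpos, ?_⟩
  rw [inner_smul_right, inner_add_right, inner_smul_right, hnw, real_inner_self_eq_norm_sq, hn,
    lt_inv_mul_iff₀ hpos]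
  nlinarith

/-- Near a regular frontier point `x` with outward normal `n`, the integral over `S` of the
derivative of a test function `φ` in the direction `w` is almost `w · n` times the surface integral
of `φ`. -/
theorem IsOutwardNormal.exists_ball_estimate (hS : IsClosed S) (harea : μHE[2] (frontier S) < ⊤)
    (h : IsOutwardNormal S x n) {ε : ℝ} (hε : 0 < ε) :
    ∃ r > 0, ∀ φ : E3 → ℝ, ContDiff ℝ 1 φ → HasCompactSupport φ → tsupport φ ⊆ Metric.ball x r →
      (∀ y, 0 ≤ φ y) → ∀ w : E3,
      |(∫ y in S, fderiv ℝ φ y w) - ⟪w, n⟫ * ∫ y in frontier S, φ y ∂μHE[2]| ≤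
        ε * ‖w‖ * ∫ y in frontier S, φ y ∂μHE[2] := by
  have hn := h.norm_eq_one
  -- `c` is the size of the tilt, and `c / 2` the flatness. The normal part costs `c ^ 2 / 2` and
  -- the tangential part `c`, together at most `ε`.
  set c : ℝ := min 1 (ε / 2) with hc
  have hc0 : 0 < c := by positivity
  have hc1 : c ≤ 1 := min_le_left _ _
  have hcε : c ≤ ε / 2 := min_le_right _ _
  obtain ⟨r, hr, hflat, hmono⟩ := h.exists_ball_mono (δ := c / 2) (by positivity)
  refine ⟨r, hr, fun φ hφ hcs hsub hpos w => ?_⟩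
  set I := ∫ y in frontier S, φ y ∂μHE[2] with hI
  have hI0 : 0 ≤ I := integral_nonneg hpos
  have hint : ∀ w, IntegrableOn (fun y => fderiv ℝ φ y w) S volume := fun w =>
    (Continuous.integrable_of_hasCompactSupport
      ((hφ.continuous_fderiv one_ne_zero).clm_apply continuous_const)
      (hcs.fderiv_apply ℝ w)).integrableOn
  set L : E3 → ℝ := fun w => ∫ y in S, fderiv ℝ φ y w with hL
  have hadd : ∀ v w, L (v + w) = L v + L w := fun v w => by
    simp only [hL, map_add]
    exact integral_add (hint v) (hint w)
  have hsmul : ∀ (a : ℝ) v, L (a • v) = a * L v := fun a v => by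
    simp only [hL, map_smul, smul_eq_mul]
    exact integral_const_mul a _
  have hU : ∀ e : E3, ‖e‖ = 1 → c / 2 < ⟪n, e⟫ → L e ≤ I := fun e he hne =>
    setIntegral_fderiv_le hS harea (convex_ball x r) (hmono e he hne) hφ hcs hsub he hpos
  have hnn : c / 2 < ⟪n, n⟫ := by rw [real_inner_self_eq_norm_sq, hn]; linarith
  have hLn : (1 - c ^ 2 / 2) * I ≤ L n := by
    have hpos' : (0 : ℝ) < 1 - (c / 2) ^ 2 := by nlinarith
    have h1 := setLIntegral_le_setIntegral_fderiv hS (convex_ball x r) (hmono n hn hnn)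
      (by positivity) (by linarith) hflat hφ hcs hsub hn hpos
    rw [← (integrableOn_frontier_and_ofReal_setIntegral_eq harea hφ.continuous hcs hpos).2] at h1
    have h0 := (ofReal_setIntegral_fderiv_eq hS (convex_ball x r) (hmono n hn hnn) hφ hcs hsub hn
      hpos).1
    rw [ENNReal.ofReal_le_ofReal_iff (by positivity), le_inv_mul_iff₀ hpos'] at h1
    refine le_trans ?_ h1
    rw [← hI]
    nlinarith [sq_nonneg c]
  -- The upper bound in the tilted direction reads `L n + c * L u ≤ (1 + c ^ 2 / 2) * I`.
  -- Subtracting the lower bound `hLn` leaves `c * L u ≤ c ^ 2 * I`; applying this to `-u` too gives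
  -- the absolute value.
  have hperp : ∀ u : E3, ‖u‖ = 1 → ⟪n, u⟫ = 0 → |L u| ≤ c * I := by
    have key : ∀ u : E3, ‖u‖ = 1 → ⟪n, u⟫ = 0 → L u ≤ c * I := by
      intro u hu hnu
      obtain ⟨h1, h2, h3⟩ := add_smul_orthogonal_bounds hn hu hnu (c := c)
        (by rw [abs_of_pos hc0]; exact hc1)
      have h4 := hU (‖n + c • u‖⁻¹ • (n + c • u))
        (by rw [norm_smul, norm_inv, norm_norm, inv_mul_cancel₀ h2.ne']) (by linarith)
      rw [hsmul, inv_mul_le_iff₀ h2, hadd, hsmul] at h4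
      have h5 : c * L u ≤ c * (c * I) := by nlinarith
      exact le_of_mul_le_mul_left h5 hc0
    intro u hu hnu
    refine abs_le.2 ⟨?_, key u hu hnu⟩
    have := key (-u) (by rwa [norm_neg]) (by rw [inner_neg_right, hnu, neg_zero])
    have h2 : L (-u) = - L u := by simpa using hsmul (-1) u
    linarith
  change |L w - ⟪w, n⟫ * I| ≤ _
  set a := ⟪w, n⟫ with ha
  set v := w - a • n with hv
  have hnv : ⟪n, v⟫ = 0 := by
    rw [hv, inner_sub_right, inner_smul_right, real_inner_self_eq_norm_sq, hn, ha,
      real_inner_comm]; ring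
  have ha' : |a| ≤ ‖w‖ := by simpa [hn] using abs_real_inner_le_norm w n
  have hwv : w = a • n + v := by rw [hv]; abel
  have hvn : ‖v‖ ≤ ‖w‖ := by
    have h1 : ‖w‖ ^ 2 = a ^ 2 + ‖v‖ ^ 2 := by
      conv_lhs => rw [hwv]
      rw [norm_add_sq_real, real_inner_smul_left, hnv, norm_smul, hn, Real.norm_eq_abs, mul_one,
        sq_abs]; ring
    exact abs_le_of_sq_le_sq' (by nlinarith [sq_nonneg a]) (norm_nonneg w) |>.2
  have hLv : |L v| ≤ c * ‖v‖ * I := by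
    rcases eq_or_ne v 0 with h0 | h0
    · have : L v = 0 := by rw [h0]; simpa using hsmul 0 0
      rw [this, abs_zero]; positivity
    · have hv0 : 0 < ‖v‖ := norm_pos_iff.2 h0
      have h1 := hperp (‖v‖⁻¹ • v) (by rw [norm_smul, norm_inv, norm_norm, inv_mul_cancel₀ hv0.ne'])
        (by rw [inner_smul_right, hnv, mul_zero])
      rw [hsmul, abs_mul, abs_inv, abs_norm, inv_mul_le_iff₀ hv0] at h1
      linarith
  have hLn' : |L n - I| ≤ c ^ 2 / 2 * I := by
    rw [abs_le]
    have := hU n hn hnn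
    constructor <;> nlinarith [sq_nonneg c]
  have h6 : L w - a * I = a * (L n - I) + L v := by
    conv_lhs => rw [hwv]
    rw [hadd, hsmul]; ring
  rw [h6]
  calc |a * (L n - I) + L v| ≤ |a| * |L n - I| + |L v| := by
        rw [← abs_mul]; exact abs_add_le _ _
    _ ≤ ‖w‖ * (c ^ 2 / 2 * I) + c * ‖w‖ * I := by
        gcongr
        exact hLv.trans (by gcongr)
    _ ≤ ε * ‖w‖ * I := by
        have h7 : c ^ 2 / 2 + c ≤ ε := by nlinarith
        have h8 : 0 ≤ ‖w‖ * I := by positivity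
        nlinarith

end Fluid

/-! ### The normal field, and the Gauss formula away from the singular set -/

namespace Fluid

open scoped RealInnerProductSpace NNReal ENNReal Manifold ContDiff

variable {S : Set E3} {x n : E3} {φ : E3 → ℝ}

theorem eq_zero_of_mem_frontier {g : E3 → ℝ} (hS : ∀ᶠ y in 𝓝 x, y ∈ S ↔ g y ≤ 0)
    (hg : ContinuousAt g x) (hx : x ∈ frontier S) : g x = 0 := by
  rcases lt_trichotomy (g x) 0 with h | h | h
  · refine absurd (mem_interior_iff_mem_nhds.2 ?_) hx.2
    filter_upwards [hg.eventually_lt continuousAt_const h, hS] with z hz hzS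
    exact hzS.2 hz.le
  · exact h
  · have h1 := hx.1
    rw [mem_closure_iff_frequently] at h1
    refine absurd h1 (Filter.not_frequently.2 ?_)
    filter_upwards [continuousAt_const.eventually_lt hg h, hS] with z hz hzS hmem
    exact absurd (hzS.1 hmem) (not_le.2 hz)

theorem IsOutwardNormal.mem (h : IsOutwardNormal S x n) : x ∈ S := by
  obtain ⟨g, -, hgx, -, hS, -⟩ := h
  exact hS.self_of_nhds.2 hgx.le

theorem IsOutwardNormal.mem_frontier (h : IsOutwardNormal S x n) : x ∈ frontier S := by
  refine ⟨subset_closure h.mem, fun hint => ?_⟩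
  obtain ⟨g, hg, hgx, hG, hS, -⟩ := h
  have hmax : IsLocalMax g x := by
    filter_upwards [hS, mem_interior_iff_mem_nhds.1 hint] with y hy hyS
    rw [hgx]
    exact hy.1 hyS
  apply hG
  rw [gradient, hmax.fderiv_eq_zero, map_zero]

/-- If `n ≠ m`, then `v = m - n` points inward as seen by `n` and outward as seen by `m`: a small
step along `v` stays in `S` by the first, and then `x` is interior by the second. -/
theorem IsOutwardNormal.unique {m : E3} (h : IsOutwardNormal S x n) (h' : IsOutwardNormal S x m) :
    n = m := by
  by_contra hne
  set v := m - n with hv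
  have hv0 : 0 < ‖v‖ := norm_pos_iff.2 (sub_ne_zero.2 (Ne.symm hne))
  have hn := h.norm_eq_one
  have hm := h'.norm_eq_one
  have hsq : ‖v‖ ^ 2 = 2 - 2 * ⟪n, m⟫ := by
    rw [hv, norm_sub_sq_real, hn, hm, real_inner_comm]; ring
  have h1 : ⟪m, v⟫ = ‖v‖ ^ 2 / 2 := by
    rw [hsq, hv, inner_sub_right, real_inner_self_eq_norm_sq, hm, real_inner_comm]; ring
  have h2 : ⟪n, v⟫ = -(‖v‖ ^ 2 / 2) := by
    rw [hsq, hv, inner_sub_right, real_inner_self_eq_norm_sq, hn]; ring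
  -- The inner products of `v` with the normals are `±‖v‖ ^ 2 / 2`, so `δ * ‖v‖` is half their size
  -- and the cone conditions are strict.
  set δ := ‖v‖ / 4 with hδ
  obtain ⟨r, hr, -, h3⟩ := h.exists_ball (δ := δ) (by positivity)
  obtain ⟨r', hr', -, h4⟩ := h'.exists_ball (δ := δ) (by positivity)
  set ε := min r r' / (2 * ‖v‖) with hε
  have hmin : 0 < min r r' := lt_min hr hr'
  have hε0 : 0 < ε := by positivity
  have hεv : ε * ‖v‖ < min r r' := by
    rw [hε]; field_simp; linarith
  have hdist : dist (x + ε • v) x < min r r' := by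
    rw [dist_eq_norm, add_sub_cancel_left, norm_smul, Real.norm_eq_abs, abs_of_pos hε0]
    exact hεv
  have hmem : x + ε • v ∈ S := by
    apply interior_subset
    refine h3 (x + ε • v) (hdist.trans_le (min_le_left _ _)) x ⟨h.mem, Metric.mem_ball_self hr⟩ ?_
    rw [sub_add_cancel_left, norm_neg, inner_neg_right, norm_smul, inner_smul_right, h2,
      Real.norm_eq_abs, abs_of_pos hε0]
    have : 0 < ε * ‖v‖ ^ 2 := by positivity
    nlinarith
  refine h.mem_frontier.2 (h4 x (Metric.mem_ball_self hr') _
    ⟨hmem, hdist.trans_le (min_le_right _ _)⟩ ?_)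
  rw [add_sub_cancel_left, norm_smul, inner_smul_right, h1, Real.norm_eq_abs, abs_of_pos hε0]
  have : 0 < ε * ‖v‖ ^ 2 := by positivity
  nlinarith

theorem IsOutwardNormal.outwardNormal_eq (h : IsOutwardNormal S x n) : outwardNormal S x = n := by
  have hex : ∃ m, IsOutwardNormal S x m := ⟨n, h⟩
  rw [outwardNormal, dif_pos hex]
  exact hex.choose_spec.unique h

theorem norm_outwardNormal_le (S : Set E3) (x : E3) : ‖outwardNormal S x‖ ≤ 1 := by
  by_cases hex : ∃ m, IsOutwardNormal S x m
  · rw [outwardNormal, dif_pos hex, hex.choose_spec.norm_eq_one]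
  · rw [outwardNormal, dif_neg hex, norm_zero]; exact zero_le_one

/-- The same defining function `g` works at all nearby frontier points, so by uniqueness the normal
there is the normalised gradient of `g`, which is continuous. -/
theorem IsOutwardNormal.eventually (h : IsOutwardNormal S x n) :
    (∀ᶠ y in 𝓝 x, y ∈ frontier S → ∃ m, IsOutwardNormal S y m) ∧
      ContinuousWithinAt (outwardNormal S) (frontier S) x := by
  have hx := h.mem_frontier
  have heq := h.outwardNormal_eq
  obtain ⟨g, hg, hgx, hG, hS, rfl⟩ := h
  have hgrad : ContinuousAt (gradient g) x :=
    (InnerProductSpace.toDual ℝ E3).symm.continuous.continuousAt.comp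
      (hg.fderiv_right (m := 0) (by simp)).continuousAt
  have hev : ∀ᶠ y in 𝓝 x, y ∈ frontier S →
      IsOutwardNormal S y (‖gradient g y‖⁻¹ • gradient g y) := by
    filter_upwards [hg.eventually (by simp), hgrad.eventually_ne hG, hS.eventually_nhds]
      with y hy1 hy2 hy3 hy
    exact ⟨g, hy1, eq_zero_of_mem_frontier hy3 hy1.continuousAt hy, hy2, hy3, rfl⟩
  refine ⟨hev.mono fun y hy hyf => ⟨_, hy hyf⟩, ?_⟩
  have hcont : ContinuousWithinAt (fun y => ‖gradient g y‖⁻¹ • gradient g y) (frontier S) x :=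
    ((hgrad.norm.inv₀ (norm_ne_zero_iff.2 hG)).smul hgrad).continuousWithinAt
  refine hcont.congr_of_eventuallyEq ?_ heq
  filter_upwards [mem_nhdsWithin_of_mem_nhds hev, self_mem_nhdsWithin] with y hy hyf
  exact (hy hyf).outwardNormal_eq

/-- The frontier points without an outward normal. -/
def singularSet (S : Set E3) : Set E3 := {x ∈ frontier S | ¬ ∃ n, IsOutwardNormal S x n}

theorem isClosed_singularSet (S : Set E3) : IsClosed (singularSet S) := by
  rw [← isOpen_compl_iff, isOpen_iff_mem_nhds]
  intro x hx
  by_cases hxf : x ∈ frontier S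
  · have hreg : ∃ n, IsOutwardNormal S x n := by
      by_contra hcon
      exact hx ⟨hxf, hcon⟩
    obtain ⟨n, hn⟩ := hreg
    filter_upwards [hn.eventually.1] with y hy hys
    exact hys.2 (hy hys.1)
  · filter_upwards [isClosed_frontier.isOpen_compl.mem_nhds hxf] with y hy hys
    exact hy hys.1

theorem continuousOn_outwardNormal (S : Set E3) :
    ContinuousOn (outwardNormal S) (frontier S \ singularSet S) := by
  rintro x ⟨hx, hxs⟩
  have hreg : ∃ n, IsOutwardNormal S x n := by
    by_contra hcon
    exact hxs ⟨hx, hcon⟩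
  exact hreg.choose_spec.eventually.2.mono sdiff_subset

theorem IsRegion.aestronglyMeasurable_outwardNormal (hS : IsRegion S) :
    AEStronglyMeasurable (outwardNormal S) ((μHE[2] : Measure E3).restrict (frontier S)) := by
  have h1 : (frontier S \ singularSet S : Set E3) =ᵐ[μHE[2]] frontier S :=
    sdiff_null_ae_eq_self hS.area_singular
  rw [← Measure.restrict_congr_set h1]
  exact (continuousOn_outwardNormal S).aestronglyMeasurable
    (isClosed_frontier.measurableSet.diff (isClosed_singularSet S).measurableSet)

theorem IsRegion.integrableOn_continuous (hS : IsRegion S) {f : E3 → ℝ}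
    (hf : ContinuousOn f (frontier S)) : IntegrableOn f (frontier S) μHE[2] := by
  have hK : IsCompact (frontier S) :=
    hS.isCompact.of_isClosed_subset isClosed_frontier hS.isCompact.isClosed.frontier_subset
  obtain ⟨C, hC⟩ := hK.exists_bound_of_continuousOn hf
  have : Fact (μHE[2] (frontier S) < ⊤) := ⟨hS.area_lt_top⟩
  exact Integrable.of_bound (hf.aestronglyMeasurable isClosed_frontier.measurableSet) C
    ((ae_restrict_iff' isClosed_frontier.measurableSet).2 (ae_of_all _ hC))

theorem IsRegion.integrableOn_mul_inner (hS : IsRegion S) {f : E3 → ℝ}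
    (hf : ContinuousOn f (frontier S)) (w : E3) :
    IntegrableOn (fun y => f y * ⟪w, outwardNormal S y⟫) (frontier S) μHE[2] := by
  refine (hS.integrableOn_continuous hf).mul_bdd (c := ‖w‖) ?_ (ae_of_all _ fun y => ?_)
  · exact aestronglyMeasurable_const.inner hS.aestronglyMeasurable_outwardNormal
  · refine (norm_inner_le_norm _ _).trans ?_
    exact mul_le_of_le_one_right (norm_nonneg _) (norm_outwardNormal_le S y)

theorem integral_fderiv_eq_zero (hφ : ContDiff ℝ 1 φ) (hc : HasCompactSupport φ) (w : E3) :
    ∫ y, fderiv ℝ φ y w = 0 := by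
  have hint : Integrable (fun y => fderiv ℝ φ y w) :=
    Continuous.integrable_of_hasCompactSupport
      ((hφ.continuous_fderiv one_ne_zero).clm_apply continuous_const) (hc.fderiv_apply ℝ w)
  have := integral_mul_fderiv_eq_neg_fderiv_mul_of_integrable (μ := (volume : Measure E3))
    (f := fun _ : E3 => (1 : ℝ)) (g := φ) (v := w) (by simp) (by simpa using hint)
    (by simpa using hφ.continuous.integrable_of_hasCompactSupport hc)
    (by simp) (fun y _ => hφ.differentiable one_ne_zero y)
  simpa using this

/-- A ball is connected, so if it misses the frontier it lies in `S` or is disjoint from it. -/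
theorem setIntegral_fderiv_eq_zero_of_ball {r : ℝ} (hr : Disjoint (Metric.ball x r) (frontier S))
    (hφ : ContDiff ℝ 1 φ) (hc : HasCompactSupport φ) (hsub : tsupport φ ⊆ Metric.ball x r) (w : E3) :
    ∫ y in S, fderiv ℝ φ y w = 0 := by
  classical
  have hzero : ∀ y ∉ Metric.ball x r, fderiv ℝ φ y w = 0 := fun y hy => by
    rw [image_eq_zero_of_notMem_tsupport fun h => hy (hsub (tsupport_fderiv_subset ℝ h))]; rfl
  have hpre : IsPreconnected (Metric.ball x r) := (convex_ball x r).isPreconnected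
  by_cases hne : (Metric.ball x r ∩ S).Nonempty
  · have hss : Metric.ball x r ⊆ S := by
      refine Subset.trans ?_ interior_subset
      apply hpre.subset_of_closure_inter_subset isOpen_interior
      · obtain ⟨y, hy, hyS⟩ := hne
        refine ⟨y, hy, ?_⟩
        by_contra hcon
        exact disjoint_left.1 hr hy ⟨subset_closure hyS, hcon⟩
      · rintro y ⟨hy, hyb⟩
        by_contra hcon
        exact disjoint_left.1 hr hyb ⟨closure_mono interior_subset hy, hcon⟩
    rw [setIntegral_eq_integral_of_forall_compl_eq_zero fun y hy => hzero y fun h => hy (hss h)]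
    exact integral_fderiv_eq_zero hφ hc w
  · refine setIntegral_eq_zero_of_forall_eq_zero fun y hy => hzero y fun h => hne ⟨y, h, hy⟩

/-- Local form of the Gauss formula up to an error `ε`, near any point which is not singular. -/
theorem IsRegion.exists_ball_estimate (hS : IsRegion S) (hx : x ∉ singularSet S) {ε : ℝ}
    (hε : 0 < ε) :
    ∃ r > 0, ∀ φ : E3 → ℝ, ContDiff ℝ 1 φ → HasCompactSupport φ → tsupport φ ⊆ Metric.ball x r →
      (∀ y, 0 ≤ φ y) → ∀ w : E3,
      |(∫ y in S, fderiv ℝ φ y w) - ∫ y in frontier S, φ y * ⟪w, outwardNormal S y⟫ ∂μHE[2]| ≤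
        ε * ‖w‖ * ∫ y in frontier S, φ y ∂μHE[2] := by
  by_cases hxf : x ∈ frontier S
  · have hreg : ∃ n, IsOutwardNormal S x n := by
      by_contra hcon
      exact hx ⟨hxf, hcon⟩
    obtain ⟨n, hn⟩ := hreg
    obtain ⟨r₁, hr₁, h1⟩ := hn.exists_ball_estimate hS.isCompact.isClosed hS.area_lt_top
      (half_pos hε)
    -- Half of `ε` pays for the estimate with the fixed normal `n`, the other half for replacing `n`
    -- by the varying normal.
    obtain ⟨r₂, hr₂, h2⟩ := Metric.continuousWithinAt_iff.1 hn.eventually.2 (ε / 2) (half_pos hε)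
    rw [hn.outwardNormal_eq] at h2
    refine ⟨min r₁ r₂, lt_min hr₁ hr₂, fun φ hφ hc hsub hpos w => ?_⟩
    have h3 := h1 φ hφ hc (hsub.trans (Metric.ball_subset_ball (min_le_left _ _))) hpos w
    have hi := hS.integrableOn_mul_inner hφ.continuous.continuousOn w
    have hi' := hS.integrableOn_continuous (f := φ) hφ.continuous.continuousOn
    have h4 : |⟪w, n⟫ * (∫ y in frontier S, φ y ∂μHE[2])
        - ∫ y in frontier S, φ y * ⟪w, outwardNormal S y⟫ ∂μHE[2]| ≤
        ε / 2 * ‖w‖ * ∫ y in frontier S, φ y ∂μHE[2] := by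
      rw [← integral_const_mul, ← integral_sub (hi'.const_mul _) hi, ← integral_const_mul,
        ← Real.norm_eq_abs]
      refine norm_integral_le_of_norm_le (hi'.const_mul _) ?_
      rw [ae_restrict_iff' isClosed_frontier.measurableSet]
      refine ae_of_all _ fun y hy => ?_
      by_cases hyt : y ∈ tsupport φ
      · have h5 := h2 hy ((Metric.mem_ball.1 (hsub hyt)).trans_le (min_le_right _ _))
        rw [dist_eq_norm, norm_sub_rev] at h5
        have h6 : ⟪w, n⟫ * φ y - φ y * ⟪w, outwardNormal S y⟫
            = φ y * ⟪w, n - outwardNormal S y⟫ := by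
          rw [inner_sub_right]; ring
        rw [h6, norm_mul, Real.norm_of_nonneg (hpos y)]
        calc φ y * ‖⟪w, n - outwardNormal S y⟫‖ ≤ φ y * (‖w‖ * (ε / 2)) := by
              gcongr
              · exact hpos y
              · exact (norm_inner_le_norm _ _).trans (by gcongr)
          _ = ε / 2 * ‖w‖ * φ y := by ring
      · simp [image_eq_zero_of_notMem_tsupport hyt]
    calc _ ≤ _ := abs_sub_le _ (⟪w, n⟫ * (∫ y in frontier S, φ y ∂μHE[2])) _
      _ ≤ _ := add_le_add h3 h4
      _ = _ := by ring
  · obtain ⟨r, hr, hball⟩ := Metric.isOpen_iff.1 isClosed_frontier.isOpen_compl x hxf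
    refine ⟨r, hr, fun φ hφ hc hsub hpos w => ?_⟩
    have hdisj : Disjoint (Metric.ball x r) (frontier S) := disjoint_left.2 fun y hy => hball hy
    have h0 : ∀ y ∈ frontier S, φ y = 0 := fun y hy =>
      image_eq_zero_of_notMem_tsupport fun h => hball (hsub h) hy
    rw [setIntegral_fderiv_eq_zero_of_ball hdisj hφ hc hsub w,
      setIntegral_eq_zero_of_forall_eq_zero (f := φ) h0,
      setIntegral_eq_zero_of_forall_eq_zero fun y hy => by rw [h0 y hy, zero_mul]]
    simp

/-- The local error is linear in the surface integral of the test function. Summed over a partition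
of unity it is `ε * ‖w‖` times the integral of `φ` itself, whatever the number of pieces, and `ε` is
arbitrary. -/
theorem IsRegion.setIntegral_fderiv_of_nonneg (hS : IsRegion S) (hφ : ContDiff ℝ 1 φ)
    (hc : HasCompactSupport φ) (hdisj : Disjoint (tsupport φ) (singularSet S))
    (hpos : ∀ y, 0 ≤ φ y) (w : E3) :
    ∫ y in S, fderiv ℝ φ y w = ∫ y in frontier S, φ y * ⟪w, outwardNormal S y⟫ ∂μHE[2] := by
  set I := ∫ y in frontier S, φ y ∂μHE[2] with hI
  have hI0 : 0 ≤ I := integral_nonneg hpos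
  suffices h : ∀ ε > 0, |(∫ y in S, fderiv ℝ φ y w)
      - ∫ y in frontier S, φ y * ⟪w, outwardNormal S y⟫ ∂μHE[2]| ≤ ε * ‖w‖ * I by
    rw [← sub_eq_zero, ← abs_nonpos_iff]
    refine le_of_forall_pos_le_add fun η hη => ?_
    have hden : 0 < ‖w‖ * I + 1 := by positivity
    refine (h (η / (‖w‖ * I + 1)) (by positivity)).trans ?_
    rw [zero_add, mul_assoc, div_mul_eq_mul_div, div_le_iff₀ hden]
    nlinarith
  intro ε hε
  have hloc : ∀ x : E3, ∃ r > 0, x ∈ tsupport φ → ∀ χ : E3 → ℝ, ContDiff ℝ 1 χ →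
      HasCompactSupport χ → tsupport χ ⊆ Metric.ball x r → (∀ y, 0 ≤ χ y) → ∀ w : E3,
      |(∫ y in S, fderiv ℝ χ y w) - ∫ y in frontier S, χ y * ⟪w, outwardNormal S y⟫ ∂μHE[2]| ≤
        ε * ‖w‖ * ∫ y in frontier S, χ y ∂μHE[2] := by
    intro x
    by_cases hx : x ∈ tsupport φ
    · obtain ⟨r, hr, h⟩ := hS.exists_ball_estimate (disjoint_left.1 hdisj hx) hε
      exact ⟨r, hr, fun _ => h⟩
    · exact ⟨1, one_pos, fun h => absurd h hx⟩
  choose r hr hest using hloc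
  obtain ⟨t, ht, hcover⟩ := hc.isCompact.elim_nhds_subcover (fun x => Metric.ball x (r x))
    fun x _ => Metric.ball_mem_nhds x (hr x)
  obtain ⟨f, hf⟩ := SmoothPartitionOfUnity.exists_isSubordinate 𝓘(ℝ, E3) (isClosed_tsupport φ)
    (fun i : t => Metric.ball (i : E3) (r i)) (fun i => Metric.isOpen_ball)
    (fun y hy => by
      obtain ⟨x, hx, hyx⟩ := mem_iUnion₂.1 (hcover hy)
      exact mem_iUnion.2 ⟨⟨x, hx⟩, hyx⟩)
  set χ : t → E3 → ℝ := fun i y => f i y * φ y with hχ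
  have hχ1 : ∀ i, ContDiff ℝ 1 (χ i) := fun i =>
    ((f i).contMDiff.contDiff.of_le (by exact_mod_cast le_top)).mul hφ
  have hχc : ∀ i, HasCompactSupport (χ i) := fun i => hc.mul_left
  have hχs : ∀ i, tsupport (χ i) ⊆ Metric.ball (i : E3) (r i) := fun i =>
    (tsupport_mul_subset_left).trans (hf i)
  have hχ0 : ∀ i y, 0 ≤ χ i y := fun i y => mul_nonneg (f.nonneg i y) (hpos y)
  have hsum : ∀ y, φ y = ∑ i, χ i y := by
    intro y
    rw [← Finset.sum_mul]
    by_cases hy : y ∈ tsupport φ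
    · have := f.sum_eq_one hy
      rw [finsum_eq_sum_of_fintype] at this
      rw [this, one_mul]
    · rw [image_eq_zero_of_notMem_tsupport hy, mul_zero]
  have hsum' : φ = fun y => ∑ i, χ i y := funext hsum
  have hd : ∀ y, fderiv ℝ φ y w = ∑ i, fderiv ℝ (χ i) y w := by
    intro y
    rw [hsum', fderiv_fun_sum fun i _ => (hχ1 i).differentiable one_ne_zero y]
    simp
  have hint : ∀ i, IntegrableOn (fun y => fderiv ℝ (χ i) y w) S volume := fun i =>
    (Continuous.integrable_of_hasCompactSupport
      (((hχ1 i).continuous_fderiv one_ne_zero).clm_apply continuous_const)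
      ((hχc i).fderiv_apply ℝ w)).integrableOn
  have h1 : ∫ y in S, fderiv ℝ φ y w = ∑ i, ∫ y in S, fderiv ℝ (χ i) y w := by
    simp_rw [hd]
    exact integral_finsetSum _ fun i _ => hint i
  have h2 : ∫ y in frontier S, φ y * ⟪w, outwardNormal S y⟫ ∂μHE[2]
      = ∑ i, ∫ y in frontier S, χ i y * ⟪w, outwardNormal S y⟫ ∂μHE[2] := by
    rw [← integral_finsetSum _ fun i _ =>
      hS.integrableOn_mul_inner (hχ1 i).continuous.continuousOn w]
    simp_rw [← Finset.sum_mul, ← hsum]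
  have h3 : I = ∑ i, ∫ y in frontier S, χ i y ∂μHE[2] := by
    rw [← integral_finsetSum _ fun i _ =>
      hS.integrableOn_continuous (hχ1 i).continuous.continuousOn, hI]
    simp_rw [← hsum]
  rw [h1, h2, h3, ← Finset.sum_sub_distrib, Finset.mul_sum]
  refine (Finset.abs_sum_le_sum_abs _ _).trans (Finset.sum_le_sum fun i _ => ?_)
  exact hest i (ht i i.2) (χ i) (hχ1 i) (hχc i) (hχs i) (hχ0 i) w

/-- The cutoff is one on a whole neighbourhood of `K`, so multiplying by it preserves derivatives on
`K` as well as values. -/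
theorem exists_cutoff {K U : Set E3} (hK : IsCompact K) (hU : IsOpen U) (hKU : K ⊆ U) :
    ∃ (V : Set E3) (η : E3 → ℝ), IsOpen V ∧ K ⊆ V ∧ ContDiff ℝ 1 η ∧ HasCompactSupport η ∧
      tsupport η ⊆ U ∧ (∀ y, 0 ≤ η y) ∧ ∀ y ∈ V, η y = 1 := by
  obtain ⟨O, hO1, hO2, hO3, hO4⟩ := exists_open_between_and_isCompact_closure hK hU hKU
  obtain ⟨V, hV1, hV2, hV3, -⟩ := exists_open_between_and_isCompact_closure hK hO1 hO2
  obtain ⟨η, hη1, hη2, hη3, hη4⟩ := exists_contMDiff_support_eq_eq_one_iff 𝓘(ℝ, E3) (n := 1) hO1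
    isClosed_closure hV3
  have hts : tsupport η = closure O := by rw [tsupport, hη3]
  refine ⟨V, η, hV1, hV2, by exact_mod_cast hη1.contDiff, ?_, ?_, fun y => ?_, fun y hy => ?_⟩
  · rw [HasCompactSupport, hts]; exact hO4
  · rw [hts]; exact hO3
  · exact (hη2 (mem_range_self y)).1
  · exact (hη4 y).1 (subset_closure hy)

/-- The Gauss formula for functions supported away from the singular set. -/
theorem IsRegion.setIntegral_fderiv_of_disjoint (hS : IsRegion S) (hφ : ContDiff ℝ 1 φ)
    (hc : HasCompactSupport φ) (hdisj : Disjoint (tsupport φ) (singularSet S)) (w : E3) :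
    ∫ y in S, fderiv ℝ φ y w = ∫ y in frontier S, φ y * ⟪w, outwardNormal S y⟫ ∂μHE[2] := by
  obtain ⟨C, hC⟩ := hφ.continuous.bounded_above_of_compact_support hc
  obtain ⟨V, η, -, hV, hη1, hηc, hηs, hη0, hηV⟩ := exists_cutoff hc.isCompact
    (isClosed_singularSet S).isOpen_compl (subset_compl_iff_disjoint_right.2 hdisj)
  have hηC : ContDiff ℝ 1 fun y => C * η y := contDiff_const.mul hη1
  have hηCc : HasCompactSupport fun y => C * η y := hηc.mul_left
  have hηCd : tsupport (fun y => C * η y) ⊆ (singularSet S)ᶜ :=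
    (tsupport_mul_subset_right (f := fun _ => C) (g := η)).trans hηs
  have hC0 : 0 ≤ C := (norm_nonneg _).trans (hC 0)
  -- `φ` is the difference of the nonnegative functions `φ + C * η` and `C * η`, both supported off
  -- the singular set.
  have h1 := hS.setIntegral_fderiv_of_nonneg hηC hηCc (subset_compl_iff_disjoint_right.1 hηCd)
    (fun y => mul_nonneg hC0 (hη0 y)) w
  have h2 := hS.setIntegral_fderiv_of_nonneg (φ := fun y => φ y + C * η y) (hφ.add hηC)
    (hc.add hηCc) (subset_compl_iff_disjoint_right.1 ((tsupport_add φ _).trans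
      (union_subset (subset_compl_iff_disjoint_right.2 hdisj) hηCd)))
    (fun y => by
      by_cases hy : y ∈ tsupport φ
      · rw [hηV y (hV hy), mul_one]
        linarith [(abs_le.1 (hC y)).1]
      · rw [image_eq_zero_of_notMem_tsupport hy, zero_add]
        exact mul_nonneg hC0 (hη0 y)) w
  have hint : ∀ {ψ : E3 → ℝ}, ContDiff ℝ 1 ψ → HasCompactSupport ψ →
      IntegrableOn (fun y => fderiv ℝ ψ y w) S volume := fun h h' =>
    (Continuous.integrable_of_hasCompactSupport
      ((h.continuous_fderiv one_ne_zero).clm_apply continuous_const)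
      (h'.fderiv_apply ℝ w)).integrableOn
  have h3 : ∀ y, fderiv ℝ (fun y => φ y + C * η y) y w
      = fderiv ℝ φ y w + fderiv ℝ (fun y => C * η y) y w := fun y => by
    rw [fderiv_fun_add (hφ.differentiable one_ne_zero y) (hηC.differentiable one_ne_zero y)]; rfl
  simp_rw [h3, add_mul] at h2
  rw [integral_add (hint hφ hc) (hint hηC hηCc),
    integral_add (hS.integrableOn_mul_inner hφ.continuous.continuousOn w)
      (hS.integrableOn_mul_inner hηC.continuous.continuousOn w), h1] at h2
  exact add_right_cancel h2

end Fluid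

/-! ### Removal of the singular set, and the divergence theorem -/

namespace Fluid

open scoped RealInnerProductSpace NNReal ENNReal Manifold ContDiff

variable {S N : Set E3} {x n : E3} {φ : E3 → ℝ}

/-- A compact set of area zero is covered by finitely many balls with small radii and small sum of
squared radii. -/
theorem exists_finset_cover_of_area_eq_zero (hN : IsCompact N) (h0 : μHE[2] N = 0) {ε : ℝ}
    (hε : 0 < ε) :
    ∃ (t : Finset ℕ) (c : ℕ → E3) (r : ℕ → ℝ), (∀ i ∈ t, c i ∈ N ∧ 0 < r i ∧ r i ≤ ε) ∧
      N ⊆ ⋃ i ∈ t, Metric.ball (c i) (r i) ∧ ∑ i ∈ t, r i ^ 2 ≤ ε := by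
  classical
  have hH : μH[2] N = 0 := by
    rw [Measure.euclideanHausdorffMeasure_def, Measure.smul_apply, ENNReal.smul_def, smul_eq_mul,
      mul_eq_zero] at h0
    rcases h0 with h | h
    · exact absurd (ENNReal.coe_eq_zero.1 h)
        (Measure.addHaarScalarFactor_volume_hausdorffMeasure_ne_zero 2)
    · simpa using h
  set δ : ℝ≥0 := Real.toNNReal (min (ε / 4) 1) with hδ
  have hδ0 : δ ≠ 0 := (Real.toNNReal_pos.2 (by positivity)).ne'
  have hδc : (δ : ℝ) = min (ε / 4) 1 := Real.coe_toNNReal _ (by positivity)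
  -- A covering set may have diameter zero, so each radius is enlarged by a positive `η i`. The
  -- total is below `ε / 4` to keep sums small, and below `1` so that `η i ^ 2 ≤ η i`.
  obtain ⟨η, hη0, a, hηa, haδ⟩ := NNReal.exists_pos_sum_of_countable hδ0 ℕ
  have haδ' : (a : ℝ) < min (ε / 4) 1 := by rw [← hδc]; exact_mod_cast haδ
  have hη1 : ∀ i, (η i : ℝ) ≤ a := fun i => by
    exact_mod_cast le_hasSum hηa i fun j _ => zero_le
  have hηt : ∀ t : Finset ℕ, ∑ i ∈ t, (η i : ℝ) ≤ a := fun t => by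
    exact_mod_cast sum_le_hasSum t (fun j _ => zero_le) hηa
  rw [Measure.hausdorffMeasure_apply] at hH
  have h1 := (iSup_eq_bot.1 (iSup_eq_bot.1 hH (ENNReal.ofReal (ε / 2)))) (by simpa using hε)
  have h2 : (⨅ (u : ℕ → Set E3) (_ : N ⊆ ⋃ n, u n)
      (_ : ∀ n, Metric.ediam (u n) ≤ ENNReal.ofReal (ε / 2)),
        ∑' n, ⨆ _ : (u n).Nonempty, Metric.ediam (u n) ^ (2 : ℝ)) < ENNReal.ofReal (ε / 4) := by
    rw [h1]; simpa using hε
  simp only [iInf_lt_iff] at h2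
  obtain ⟨u, hu, hud, hus⟩ := h2
  set d : ℕ → ℝ := fun i => (Metric.ediam (u i)).toReal with hd
  have hdtop : ∀ i, Metric.ediam (u i) ≠ ⊤ := fun i => ((hud i).trans_lt ENNReal.ofReal_lt_top).ne
  have hdε : ∀ i, d i ≤ ε / 2 := fun i => ENNReal.toReal_le_of_le_ofReal (by positivity) (hud i)
  have hd0 : ∀ i, 0 ≤ d i := fun i => ENNReal.toReal_nonneg
  set c : ℕ → E3 := fun i => if h : (u i ∩ N).Nonempty then h.some else 0 with hc
  have hcmem : ∀ i, (u i ∩ N).Nonempty → c i ∈ u i ∩ N := fun i h => by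
    simp only [hc, dif_pos h]; exact h.some_mem
  set r : ℕ → ℝ := fun i => d i + η i with hr
  have hr0 : ∀ i, 0 < r i := fun i => add_pos_of_nonneg_of_pos (hd0 i) (by exact_mod_cast hη0 i)
  obtain ⟨b, hb1, hbfin, hb2⟩ := hN.elim_finite_subcover_image (b := {i | (u i ∩ N).Nonempty})
    (c := fun i => Metric.ball (c i) (r i)) (fun i _ => Metric.isOpen_ball) (by
      intro y hy
      obtain ⟨i, hi⟩ := mem_iUnion.1 (hu hy)
      have hne : (u i ∩ N).Nonempty := ⟨y, hi, hy⟩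
      refine mem_iUnion₂.2 ⟨i, hne, ?_⟩
      have hdist : dist y (c i) ≤ d i := by
        rw [dist_edist]
        exact ENNReal.toReal_mono (hdtop i) (Metric.edist_le_ediam_of_mem hi (hcmem i hne).1)
      exact Metric.mem_ball.2 (hdist.trans_lt (lt_add_of_pos_right _ (by exact_mod_cast hη0 i))))
  have hmin1 : (a : ℝ) < ε / 4 := haδ'.trans_le (min_le_left _ _)
  have hmin2 : (a : ℝ) < 1 := haδ'.trans_le (min_le_right _ _)
  refine ⟨hbfin.toFinset, c, r, fun i hi => ⟨(hcmem i (hb1 (hbfin.mem_toFinset.1 hi))).2, hr0 i, ?_⟩,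
    by simpa using hb2, ?_⟩
  · have := hη1 i
    have := hdε i
    simp only [hr]
    linarith
  · have hsumd : ∑ i ∈ hbfin.toFinset, d i ^ 2 < ε / 4 := by
      rw [← ENNReal.ofReal_lt_ofReal_iff (by positivity),
        ENNReal.ofReal_sum_of_nonneg fun i _ => sq_nonneg _]
      refine lt_of_le_of_lt ?_ hus
      refine le_trans (Finset.sum_le_sum fun i hi => ?_) (ENNReal.sum_le_tsum hbfin.toFinset)
      have hne : (u i).Nonempty := (hb1 (hbfin.mem_toFinset.1 hi)).mono inter_subset_left
      refine le_trans (le_of_eq ?_) (le_iSup _ hne)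
      rw [ENNReal.ofReal_pow (hd0 i), hd, ENNReal.ofReal_toReal (hdtop i)]
      exact (ENNReal.rpow_natCast _ 2).symm
    calc ∑ i ∈ hbfin.toFinset, r i ^ 2 ≤ ∑ i ∈ hbfin.toFinset, (2 * d i ^ 2 + 2 * (η i : ℝ)) := by
          refine Finset.sum_le_sum fun i _ => ?_
          have h3 : (η i : ℝ) ≤ 1 := (hη1 i).trans hmin2.le
          have h4 : (0 : ℝ) ≤ η i := (η i).coe_nonneg
          simp only [hr]
          nlinarith [sq_nonneg (d i - η i)]
      _ = 2 * ∑ i ∈ hbfin.toFinset, d i ^ 2 + 2 * ∑ i ∈ hbfin.toFinset, (η i : ℝ) := by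
          rw [Finset.sum_add_distrib, Finset.mul_sum, Finset.mul_sum]
      _ ≤ ε := by
          have := hηt hbfin.toFinset
          linarith

/-- Scaling: the gradient is of order `1 / r` on a ball of volume of order `r ^ 3`. -/
theorem exists_bump_lintegral_fderiv_le :
    ∃ C : ℝ≥0, ∀ (c : E3) (r : ℝ), 0 < r → ∃ b : E3 → ℝ, ContDiff ℝ 1 b ∧
      (∀ y, 0 ≤ b y ∧ b y ≤ 1) ∧ (∀ y ∈ Metric.ball c r, b y = 1) ∧
      (∀ y, 2 * r ≤ dist y c → b y = 0) ∧
      ∫⁻ y, ‖fderiv ℝ b y‖ₑ ≤ C * ENNReal.ofReal (r ^ 2) := by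
  let ψ : ContDiffBump (0 : E3) := ⟨1, 2, one_pos, one_lt_two⟩
  obtain ⟨K, hK⟩ := ContDiff.lipschitzWith_of_hasCompactSupport (𝕂 := ℝ) (n := 1)
    ψ.hasCompactSupport ψ.contDiff one_ne_zero
  set v : ℝ≥0 := (volume (Metric.ball (0 : E3) 1)).toNNReal with hv
  have hv' : volume (Metric.ball (0 : E3) 1) = v :=
    (ENNReal.coe_toNNReal measure_ball_lt_top.ne).symm
  refine ⟨K * 8 * v, fun c r hr => ?_⟩
  set b : E3 → ℝ := fun y => ψ (r⁻¹ • (y - c)) with hb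
  have hb1 : ContDiff ℝ 1 b := ψ.contDiff.comp ((contDiff_id.sub contDiff_const).const_smul r⁻¹)
  have hnorm : ∀ y, ‖r⁻¹ • (y - c)‖ = dist y c / r := fun y => by
    rw [norm_smul, norm_inv, Real.norm_of_nonneg hr.le, dist_eq_norm]; ring
  have hone : ∀ y ∈ Metric.ball c r, b y = 1 := fun y hy =>
    ψ.one_of_mem_closedBall (by
      rw [mem_closedBall_zero_iff, hnorm, div_le_one hr]; exact (Metric.mem_ball.1 hy).le)
  have hzero : ∀ y, 2 * r ≤ dist y c → b y = 0 := fun y hy =>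
    ψ.zero_of_le_dist (by
      rw [dist_zero_right, hnorm, le_div_iff₀ hr]; exact hy)
  have hlip : LipschitzWith (K * Real.toNNReal r⁻¹) b := by
    refine LipschitzWith.of_dist_le_mul fun y z => ?_
    refine (hK.dist_le_mul _ _).trans (le_of_eq ?_)
    rw [dist_smul₀, dist_sub_right, NNReal.coe_mul, Real.coe_toNNReal _ (by positivity),
      norm_inv, Real.norm_of_nonneg hr.le]
    ring
  have hder : ∀ y, ‖fderiv ℝ b y‖ₑ ≤ ((K * Real.toNNReal r⁻¹ : ℝ≥0) : ℝ≥0∞) := fun y => by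
    rw [enorm_le_coe]
    exact_mod_cast norm_fderiv_le_of_lipschitz ℝ hlip
  have hsupp : ∀ y ∉ Metric.closedBall c (2 * r), fderiv ℝ b y = 0 := by
    intro y hy
    have : b =ᶠ[𝓝 y] fun _ => 0 := by
      filter_upwards [Metric.isClosed_closedBall.isOpen_compl.mem_nhds hy] with z hz
      exact hzero z (not_le.1 fun h => hz (Metric.mem_closedBall.2 h)).le
    rw [this.fderiv_eq]; simp
  refine ⟨b, hb1, fun y => ⟨ψ.nonneg, ψ.le_one⟩, hone, hzero, ?_⟩
  calc ∫⁻ y, ‖fderiv ℝ b y‖ₑ = ∫⁻ y in Metric.closedBall c (2 * r), ‖fderiv ℝ b y‖ₑ := by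
        symm
        apply setLIntegral_eq_of_support_subset
        intro y hy
        by_contra hcon
        refine hy (show ‖fderiv ℝ b y‖ₑ = 0 from ?_)
        rw [← ofReal_norm, hsupp y hcon, norm_zero, ENNReal.ofReal_zero]
    _ ≤ ∫⁻ y in Metric.closedBall c (2 * r), ((K * Real.toNNReal r⁻¹ : ℝ≥0) : ℝ≥0∞) :=
        lintegral_mono hder
    _ = ((K * 8 * v : ℝ≥0) : ℝ≥0∞) * ENNReal.ofReal (r ^ 2) := by
        rw [setLIntegral_const, Measure.addHaar_closedBall _ _ (by positivity), hv']
        simp only [finrank_euclideanSpace_fin, ENNReal.coe_mul]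
        have h8 : ENNReal.ofReal ((2 * r) ^ 3)
            = ((8 : ℝ≥0) : ℝ≥0∞) * ENNReal.ofReal (r ^ 2) * ENNReal.ofReal r := by
          rw [mul_assoc, ← ENNReal.ofReal_mul (by positivity)]
          rw [show (2 * r) ^ 3 = 8 * (r ^ 2 * r) by ring, ENNReal.ofReal_mul (by norm_num)]
          norm_num
        have hinv : ((Real.toNNReal r⁻¹ : ℝ≥0) : ℝ≥0∞) * ENNReal.ofReal r = 1 := by
          change ENNReal.ofReal r⁻¹ * ENNReal.ofReal r = 1
          rw [← ENNReal.ofReal_mul (by positivity), inv_mul_cancel₀ hr.ne', ENNReal.ofReal_one]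
        rw [h8]
        calc _ = (K : ℝ≥0∞) * (8 : ℝ≥0) * v * ENNReal.ofReal (r ^ 2) *
              (((Real.toNNReal r⁻¹ : ℝ≥0) : ℝ≥0∞) * ENNReal.ofReal r) := by ring
          _ = _ := by rw [hinv, mul_one]

/-- All factors lie in `[0, 1]`, so the product rule bounds the gradient by the plain sum, however
the supports overlap. -/
theorem prod_one_sub_bounds {ι : Type*} (t : Finset ι) {b : ι → E3 → ℝ}
    (hb : ∀ i ∈ t, ContDiff ℝ 1 (b i)) (hb01 : ∀ i ∈ t, ∀ y, 0 ≤ b i y ∧ b i y ≤ 1) :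
    ContDiff ℝ 1 (fun y => ∏ i ∈ t, (1 - b i y)) ∧
    (∀ y, 0 ≤ ∏ i ∈ t, (1 - b i y) ∧ ∏ i ∈ t, (1 - b i y) ≤ 1) ∧
    ∀ y, ‖fderiv ℝ (fun y => ∏ i ∈ t, (1 - b i y)) y‖ ≤ ∑ i ∈ t, ‖fderiv ℝ (b i) y‖ := by
  classical
  have h01 : ∀ s ⊆ t, ∀ y, 0 ≤ ∏ i ∈ s, (1 - b i y) ∧ ∏ i ∈ s, (1 - b i y) ≤ 1 := fun s hs y =>
    ⟨Finset.prod_nonneg fun i hi => sub_nonneg.2 (hb01 i (hs hi) y).2,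
      Finset.prod_le_one (fun i hi => sub_nonneg.2 (hb01 i (hs hi) y).2)
        fun i hi => sub_le_self _ (hb01 i (hs hi) y).1⟩
  have hcd : ∀ s ⊆ t, ContDiff ℝ 1 (fun y => ∏ i ∈ s, (1 - b i y)) := fun s hs =>
    contDiff_prod fun i hi => contDiff_const.sub (hb i (hs hi))
  refine ⟨hcd t subset_rfl, h01 t subset_rfl, ?_⟩
  suffices h : ∀ s ⊆ t, ∀ y, ‖fderiv ℝ (fun y => ∏ i ∈ s, (1 - b i y)) y‖ ≤
      ∑ i ∈ s, ‖fderiv ℝ (b i) y‖ from h t subset_rfl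
  intro s
  induction s using Finset.induction_on with
  | empty => intro _ y; simp
  | insert i s hi ih =>
    intro hs y
    have hs' : s ⊆ t := (Finset.subset_insert i s).trans hs
    have hit : i ∈ t := hs (Finset.mem_insert_self i s)
    have hdb := (hb i hit).differentiable one_ne_zero y
    simp only [Finset.prod_insert hi, Finset.sum_insert hi]
    rw [fderiv_fun_mul (hdb.const_sub 1) ((hcd s hs').differentiable one_ne_zero y),
      fderiv_const_sub]
    have h1 := h01 s hs' y
    have h2 := hb01 i hit y
    calc _ ≤ _ := norm_add_le _ _
      _ = (1 - b i y) * ‖fderiv ℝ (fun y => ∏ i ∈ s, (1 - b i y)) y‖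
          + (∏ i ∈ s, (1 - b i y)) * ‖fderiv ℝ (b i) y‖ := by
          rw [norm_smul, norm_smul, norm_neg, Real.norm_of_nonneg (sub_nonneg.2 h2.2),
            Real.norm_of_nonneg h1.1]
      _ ≤ 1 * ‖fderiv ℝ (fun y => ∏ i ∈ s, (1 - b i y)) y‖ + 1 * ‖fderiv ℝ (b i) y‖ := by
          gcongr
          · linarith [h2.1]
          · exact h1.2
      _ ≤ _ := by linarith [ih hs' y]

/-- A compact set of area zero has cutoff functions with small gradient in the mean. -/
theorem exists_cutoff_of_area_eq_zero (hN : IsCompact N) (h0 : μHE[2] N = 0) {ε : ℝ}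
    (hε : 0 < ε) :
    ∃ η : E3 → ℝ, ContDiff ℝ 1 η ∧ (∀ y, 0 ≤ η y ∧ η y ≤ 1) ∧ Disjoint (tsupport η) N ∧
      (∀ y, (∀ z ∈ N, ε ≤ dist y z) → η y = 1) ∧ ∫⁻ y, ‖fderiv ℝ η y‖ₑ ≤ ENNReal.ofReal ε := by
  obtain ⟨C, hC⟩ := exists_bump_lintegral_fderiv_le
  -- `ε / 2` because a bump reaches distance `2 * r` from its centre in `N`; `ε / (C + 1)` makes the
  -- gradient sum at most `ε`.
  set δ : ℝ := min (ε / 2) (ε / (C + 1)) with hδ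
  have hδ0 : 0 < δ := by positivity
  obtain ⟨t, c, r, htcr, hcov, hsum⟩ := exists_finset_cover_of_area_eq_zero hN h0 hδ0
  have hC' : ∀ i : ℕ, ∃ b : E3 → ℝ, i ∈ t → ContDiff ℝ 1 b ∧
      (∀ y, 0 ≤ b y ∧ b y ≤ 1) ∧ (∀ y ∈ Metric.ball (c i) (r i), b y = 1) ∧
      (∀ y, 2 * r i ≤ dist y (c i) → b y = 0) ∧
      ∫⁻ y, ‖fderiv ℝ b y‖ₑ ≤ C * ENNReal.ofReal (r i ^ 2) := by
    intro i
    by_cases hi : i ∈ t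
    · obtain ⟨b, hb⟩ := hC (c i) (r i) (htcr i hi).2.1
      exact ⟨b, fun _ => hb⟩
    · exact ⟨0, fun h => absurd h hi⟩
  choose b hb using hC'
  obtain ⟨h1, h2, h3⟩ := prod_one_sub_bounds t (fun i hi => (hb i hi).1) fun i hi => (hb i hi).2.1
  refine ⟨_, h1, h2, ?_, ?_, ?_⟩
  · set O : Set E3 := ⋃ i ∈ t, Metric.ball (c i) (r i) with hO
    have hOo : IsOpen O := isOpen_biUnion fun i _ => Metric.isOpen_ball
    have hsub : tsupport (fun y => ∏ i ∈ t, (1 - b i y)) ⊆ Oᶜ := by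
      refine closure_minimal ?_ hOo.isClosed_compl
      intro y hy hyO
      obtain ⟨i, hi, hyi⟩ := mem_iUnion₂.1 hyO
      exact hy (Finset.prod_eq_zero hi (by rw [(hb i hi).2.2.1 y hyi, sub_self]))
    exact disjoint_left.2 fun y hy hyN => hsub hy (hcov hyN)
  · intro y hy
    refine Finset.prod_eq_one fun i hi => ?_
    rw [(hb i hi).2.2.2.1 y, sub_zero]
    refine le_trans ?_ (hy (c i) (htcr i hi).1)
    have := (htcr i hi).2.2.trans (min_le_left _ _)
    linarith
  · calc ∫⁻ y, ‖fderiv ℝ (fun y => ∏ i ∈ t, (1 - b i y)) y‖ₑ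
        ≤ ∫⁻ y, ∑ i ∈ t, ‖fderiv ℝ (b i) y‖ₑ := by
          refine lintegral_mono fun y => ?_
          simp only [← ofReal_norm]
          rw [← ENNReal.ofReal_sum_of_nonneg fun i _ => norm_nonneg _]
          exact ENNReal.ofReal_le_ofReal (h3 y)
      _ = ∑ i ∈ t, ∫⁻ y, ‖fderiv ℝ (b i) y‖ₑ :=
          lintegral_finsetSum' _ fun i hi =>
            (((hb i hi).1.continuous_fderiv one_ne_zero).enorm).measurable.aemeasurable
      _ ≤ ∑ i ∈ t, C * ENNReal.ofReal (r i ^ 2) := Finset.sum_le_sum fun i hi => (hb i hi).2.2.2.2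
      _ = ENNReal.ofReal (C * ∑ i ∈ t, r i ^ 2) := by
          rw [← Finset.mul_sum, ← ENNReal.ofReal_sum_of_nonneg fun i _ => sq_nonneg _,
            ENNReal.ofReal_mul C.coe_nonneg, ENNReal.ofReal_coe_nnreal]
      _ ≤ ENNReal.ofReal ε := by
          apply ENNReal.ofReal_le_ofReal
          have h4 : ∑ i ∈ t, r i ^ 2 ≤ ε / (C + 1) := hsum.trans (min_le_right _ _)
          have hC0 : (0 : ℝ) ≤ C := C.coe_nonneg
          rw [le_div_iff₀ (by positivity)] at h4
          have h5 : 0 ≤ ∑ i ∈ t, r i ^ 2 := Finset.sum_nonneg fun i _ => sq_nonneg _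
          nlinarith

theorem IsRegion.isCompact_singularSet (hS : IsRegion S) : IsCompact (singularSet S) :=
  hS.isCompact.of_isClosed_subset (isClosed_singularSet S) fun _ hx =>
    hS.isCompact.isClosed.frontier_subset hx.1

theorem volume_eq_zero_of_area_ne_top (h : μHE[2] N ≠ ⊤) : volume N = 0 := by
  have h3 : (volume : Measure E3) = μHE[3] := by
    rw [EuclideanSpace.euclideanHausdorffMeasure_eq_volume]
  rw [h3]
  exact (Measure.euclideanHausdorffMeasure_zero_or_top (by norm_num : 2 < 3) N).resolve_right h

/-- The Gauss formula for the derivative of a compactly supported function. -/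
theorem IsRegion.setIntegral_fderiv (hS : IsRegion S) (hφ : ContDiff ℝ 1 φ)
    (hc : HasCompactSupport φ) (w : E3) :
    ∫ y in S, fderiv ℝ φ y w = ∫ y in frontier S, φ y * ⟪w, outwardNormal S y⟫ ∂μHE[2] := by
  obtain ⟨C, hC⟩ := hφ.continuous.bounded_above_of_compact_support hc
  have hC0 : 0 ≤ C := (norm_nonneg _).trans (hC 0)
  have hN := hS.isCompact_singularSet
  have hN0 : μHE[2] (singularSet S) = 0 := hS.area_singular
  -- The formula holds for each `η m * φ`. As `m` grows, dominated convergence handles the terms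
  -- containing `η m` undifferentiated, and the term with its derivative is at most `C * ‖w‖ / (m +
  -- 1)`.
  choose η hη1 hη01 hηd hηone hηint using fun m : ℕ =>
    exists_cutoff_of_area_eq_zero hN hN0 (ε := 1 / ((m : ℝ) + 1)) (by positivity)
  have hlim : ∀ y ∉ singularSet S, Filter.Tendsto (fun m => η m y) Filter.atTop (𝓝 1) := by
    intro y hy
    obtain ⟨r, hr, hball⟩ := Metric.isOpen_iff.1 (isClosed_singularSet S).isOpen_compl y hy
    refine tendsto_const_nhds.congr' ?_
    filter_upwards [(tendsto_one_div_add_atTop_nhds_zero_nat (𝕜 := ℝ)).eventually_lt_const hr]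
      with m hm
    refine (hηone m y fun z hz => ?_).symm
    refine hm.le.trans ?_
    by_contra hcon
    exact hball (Metric.mem_ball'.2 (not_le.1 hcon)) hz
  have hprod : ∀ m, ContDiff ℝ 1 fun y => η m y * φ y := fun m => (hη1 m).mul hφ
  have hgauss : ∀ m, ∫ y in S, fderiv ℝ (fun y => η m y * φ y) y w
      = ∫ y in frontier S, η m y * φ y * ⟪w, outwardNormal S y⟫ ∂μHE[2] := fun m =>
    hS.setIntegral_fderiv_of_disjoint (hprod m) hc.mul_left
      ((hηd m).mono_left tsupport_mul_subset_left) w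
  have hcd : Continuous fun y => fderiv ℝ φ y w :=
    (hφ.continuous_fderiv one_ne_zero).clm_apply continuous_const
  have hcη : ∀ m, Continuous fun y => fderiv ℝ (η m) y w := fun m =>
    ((hη1 m).continuous_fderiv one_ne_zero).clm_apply continuous_const
  have hi0 : Integrable fun y => fderiv ℝ φ y w :=
    hcd.integrable_of_hasCompactSupport (hc.fderiv_apply ℝ w)
  have hi1 : ∀ m, IntegrableOn (fun y => η m y * fderiv ℝ φ y w) S volume := fun m =>
    (((hη1 m).continuous.mul hcd).integrable_of_hasCompactSupport
      (hc.fderiv_apply ℝ w).mul_left).integrableOn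
  have hi2 : ∀ m, IntegrableOn (fun y => φ y * fderiv ℝ (η m) y w) S volume := fun m =>
    ((hφ.continuous.mul (hcη m)).integrable_of_hasCompactSupport hc.mul_right).integrableOn
  have hsplit : ∀ m, ∫ y in S, fderiv ℝ (fun y => η m y * φ y) y w
      = (∫ y in S, η m y * fderiv ℝ φ y w) + ∫ y in S, φ y * fderiv ℝ (η m) y w := by
    intro m
    rw [← integral_add (hi1 m) (hi2 m)]
    congr 1
    funext y
    rw [fderiv_fun_mul ((hη1 m).differentiable one_ne_zero y) (hφ.differentiable one_ne_zero y)]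
    rfl
  have hlim1 : Filter.Tendsto (fun m => ∫ y in frontier S,
      η m y * φ y * ⟪w, outwardNormal S y⟫ ∂μHE[2]) Filter.atTop
      (𝓝 (∫ y in frontier S, φ y * ⟪w, outwardNormal S y⟫ ∂μHE[2])) := by
    have hI := hS.integrableOn_mul_inner hφ.continuous.continuousOn w
    refine tendsto_integral_of_dominated_convergence
      (fun y => ‖φ y * ⟪w, outwardNormal S y⟫‖) (fun m => ?_) hI.norm (fun m => ?_) ?_
    · exact (hS.integrableOn_mul_inner (hprod m).continuous.continuousOn w).1
    · refine ae_of_all _ fun y => ?_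
      rw [mul_assoc, norm_mul, Real.norm_of_nonneg (hη01 m y).1]
      exact mul_le_of_le_one_left (norm_nonneg _) (hη01 m y).2
    · have hae : ∀ᵐ y ∂(μHE[2] : Measure E3), y ∉ singularSet S := measure_eq_zero_iff_ae_notMem.1 hN0
      filter_upwards [ae_restrict_of_ae hae] with y hy
      simpa [mul_assoc] using (hlim y hy).mul_const (φ y * ⟪w, outwardNormal S y⟫)
  have hlim2 : Filter.Tendsto (fun m => ∫ y in S, η m y * fderiv ℝ φ y w) Filter.atTop
      (𝓝 (∫ y in S, fderiv ℝ φ y w)) := by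
    refine tendsto_integral_of_dominated_convergence
      (fun y => ‖fderiv ℝ φ y w‖) (fun m => (hi1 m).1) hi0.integrableOn.norm (fun m => ?_) ?_
    · refine ae_of_all _ fun y => ?_
      rw [norm_mul, Real.norm_of_nonneg (hη01 m y).1]
      exact mul_le_of_le_one_left (norm_nonneg _) (hη01 m y).2
    · have hae : ∀ᵐ y, y ∉ singularSet S := measure_eq_zero_iff_ae_notMem.1
        (volume_eq_zero_of_area_ne_top (by rw [hN0]; simp))
      filter_upwards [ae_restrict_of_ae hae] with y hy
      simpa using (hlim y hy).mul_const (fderiv ℝ φ y w)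
  have hlim3 : Filter.Tendsto (fun m => ∫ y in S, φ y * fderiv ℝ (η m) y w) Filter.atTop (𝓝 0) := by
    refine squeeze_zero_norm (a := fun m : ℕ => C * ‖w‖ * (1 / ((m : ℝ) + 1))) (fun m => ?_) ?_
    · rw [← ENNReal.ofReal_le_ofReal_iff (by positivity), ofReal_norm]
      calc ‖∫ y in S, φ y * fderiv ℝ (η m) y w‖ₑ ≤ ∫⁻ y in S, ‖φ y * fderiv ℝ (η m) y w‖ₑ :=
            enorm_integral_le_lintegral_enorm _
        _ ≤ ∫⁻ y, ‖φ y * fderiv ℝ (η m) y w‖ₑ := setLIntegral_le_lintegral _ _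
        _ ≤ ∫⁻ y, ENNReal.ofReal (C * ‖w‖) * ‖fderiv ℝ (η m) y‖ₑ := by
            refine lintegral_mono fun y => ?_
            simp only [← ofReal_norm]
            rw [← ENNReal.ofReal_mul (by positivity)]
            apply ENNReal.ofReal_le_ofReal
            rw [norm_mul, mul_assoc]
            gcongr
            · exact hC y
            · rw [mul_comm]; exact ContinuousLinearMap.le_opNorm _ _
        _ = ENNReal.ofReal (C * ‖w‖) * ∫⁻ y, ‖fderiv ℝ (η m) y‖ₑ :=
            lintegral_const_mul' _ _ ENNReal.ofReal_ne_top
        _ ≤ ENNReal.ofReal (C * ‖w‖) * ENNReal.ofReal (1 / ((m : ℝ) + 1)) := by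
            gcongr
            exact hηint m
        _ = _ := by rw [← ENNReal.ofReal_mul (by positivity)]
    · simpa using (tendsto_one_div_add_atTop_nhds_zero_nat (𝕜 := ℝ)).const_mul (C * ‖w‖)
  have hlim4 := hlim2.add hlim3
  simp_rw [← hsplit, hgauss, add_zero] at hlim4
  exact tendsto_nhds_unique hlim4 hlim1

/-- The divergence theorem. -/
theorem IsRegion.setIntegral_divergence (hS : IsRegion S) {U : Set E3} (hU : IsOpen U)
    (hSU : S ⊆ U) {v : E3 → E3} (hv : ContDiffOn ℝ 1 v U) :
    ∫ y in S, divergence v y = surfaceIntegral S fun y n => ∑ i, v y i * n i := by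
  obtain ⟨V, η, hV, hSV, hη1, hηc, hηs, -, hηV⟩ := exists_cutoff hS.isCompact hU hSU
  have hvi : ∀ i, ContDiffOn ℝ 1 (fun y => v y i) U := fun i => contDiffOn_euclidean.1 hv i
  -- `v` is `C¹` only on `U`; the cutoff makes each component globally `C¹` and leaves its
  -- derivatives on `S` unchanged.
  have hφ : ∀ i, ContDiff ℝ 1 fun y => η y * v y i := by
    intro i
    rw [contDiff_iff_contDiffAt]
    intro y
    by_cases hy : y ∈ tsupport η
    · exact hη1.contDiffAt.mul ((hvi i).contDiffAt (hU.mem_nhds (hηs hy)))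
    · have : (fun y => η y * v y i) =ᶠ[𝓝 y] fun _ => 0 := by
        filter_upwards [(isClosed_tsupport η).isOpen_compl.mem_nhds hy] with z hz
        rw [image_eq_zero_of_notMem_tsupport hz, zero_mul]
      exact contDiffAt_const.congr_of_eventuallyEq this
  have hφc : ∀ i, HasCompactSupport fun y => η y * v y i := fun i => hηc.mul_right
  have heq : ∀ i, ∀ y ∈ S, pderiv i (fun y => v y i) y
      = fderiv ℝ (fun y => η y * v y i) y (EuclideanSpace.single i 1) := by
    intro i y hy
    have : (fun y => η y * v y i) =ᶠ[𝓝 y] fun y => v y i := by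
      filter_upwards [hV.mem_nhds (hSV hy)] with z hz
      rw [hηV z hz, one_mul]
    rw [pderiv, this.fderiv_eq]
  have hint : ∀ i, IntegrableOn (fun y => fderiv ℝ (fun y => η y * v y i) y
      (EuclideanSpace.single i 1)) S volume := fun i =>
    (Continuous.integrable_of_hasCompactSupport
      (((hφ i).continuous_fderiv one_ne_zero).clm_apply continuous_const)
      ((hφc i).fderiv_apply ℝ _)).integrableOn
  have h1 : ∫ y in S, divergence v y = ∑ i, ∫ y in S, fderiv ℝ (fun y => η y * v y i) y
      (EuclideanSpace.single i 1) := by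
    rw [← integral_finsetSum _ fun i _ => hint i]
    exact setIntegral_congr_fun hS.isCompact.isClosed.measurableSet fun y hy =>
      Finset.sum_congr rfl fun i _ => heq i y hy
  rw [h1, surfaceIntegral]
  simp_rw [fun i => hS.setIntegral_fderiv (hφ i) (hφc i) (EuclideanSpace.single i 1)]
  rw [← integral_finsetSum _ fun i _ => hS.integrableOn_mul_inner (hφ i).continuous.continuousOn _]
  refine setIntegral_congr_fun isClosed_frontier.measurableSet fun y hy => ?_
  have hyS := hS.isCompact.isClosed.frontier_subset hy
  refine Finset.sum_congr rfl fun i _ => ?_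
  rw [hηV y (hSV hyS), one_mul, EuclideanSpace.inner_single_left]
  simp

end Fluid

/-! ### Balls are regions, and diffeomorphisms preserve regions -/

namespace Fluid

open scoped RealInnerProductSpace NNReal ENNReal Manifold ContDiff

variable {S U : Set E3} {x n : E3} {f : E3 → E3}

theorem isRegion_of_forall_outwardNormal (hS : IsCompact S)
    (h : ∀ x ∈ frontier S, ∃ n, IsOutwardNormal S x n) : IsRegion S := by
  refine ⟨hS, ?_, ?_⟩
  · have hK : IsCompact (frontier S) :=
      hS.of_isClosed_subset isClosed_frontier hS.isClosed.frontier_subset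
    refine hK.measure_lt_top_of_nhdsWithin fun x hx => ?_
    obtain ⟨n, hn⟩ := h x hx
    obtain ⟨r, hr, hlt⟩ := hn.exists_area_lt_top hS.isClosed
    exact ⟨frontier S ∩ Metric.ball x r,
      inter_mem_nhdsWithin _ (Metric.ball_mem_nhds x hr), hlt⟩
  · have : {x ∈ frontier S | ¬ ∃ n, IsOutwardNormal S x n} = ∅ :=
      eq_empty_of_forall_notMem fun x hx => hx.2 (h x hx.1)
    rw [this, measure_empty]

/-- The function `‖y - c‖ ^ 2 - r ^ 2` defines the ball; its gradient is nonzero on the sphere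
because its radial derivative at `x` along `x - c` is `2 * r ^ 2`. -/
theorem isRegion_closedBall (c : E3) {r : ℝ} (hr : 0 < r) : IsRegion (Metric.closedBall c r) := by
  refine isRegion_of_forall_outwardNormal (isCompact_closedBall c r) fun x hx => ?_
  rw [frontier_closedBall c hr.ne'] at hx
  have hxr : ‖x - c‖ = r := by rw [← dist_eq_norm]; exact hx
  set g : E3 → ℝ := fun y => ‖y - c‖ ^ 2 - r ^ 2 with hg
  have hgc : ContDiff ℝ 1 g := ((contDiff_id.sub contDiff_const).norm_sq ℝ).sub contDiff_const
  refine ⟨_, g, hgc.contDiffAt, by simp [hg, hxr], ?_, ?_, rfl⟩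
  · intro h0
    have hder : HasDerivAt (fun t : ℝ => g (x + t • (x - c))) 0 0 := by
      have h1 : fderiv ℝ g x = 0 := by
        rw [gradient] at h0
        exact (LinearIsometryEquiv.map_eq_zero_iff _).1 h0
      have h2 : HasFDerivAt g (0 : E3 →L[ℝ] ℝ) (x + (0 : ℝ) • (x - c)) := by
        rw [zero_smul, add_zero, ← h1]
        exact (hgc.differentiable one_ne_zero x).hasFDerivAt
      have h3 : HasDerivAt (fun t : ℝ => x + t • (x - c)) (x - c) 0 := by
        simpa using ((hasDerivAt_id (0 : ℝ)).smul_const (x - c)).const_add x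
      exact h2.comp_hasDerivAt (0 : ℝ) h3
    have heq : (fun t : ℝ => g (x + t • (x - c))) = fun t : ℝ => (1 + t) ^ 2 * r ^ 2 - r ^ 2 := by
      funext t
      have : x + t • (x - c) - c = (1 + t) • (x - c) := by rw [add_smul, one_smul]; abel
      simp only [hg]
      rw [this, norm_smul, hxr, mul_pow, Real.norm_eq_abs, sq_abs]
    rw [heq] at hder
    have h4 : HasDerivAt (fun t : ℝ => (1 + t) ^ 2 * r ^ 2 - r ^ 2) (2 * r ^ 2) 0 := by
      have := ((((hasDerivAt_id (0 : ℝ)).const_add 1).pow 2).mul_const (r ^ 2)).sub_const (r ^ 2)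
      simpa using this
    have := hder.unique h4
    have : 0 < r ^ 2 := by positivity
    linarith
  · refine Filter.Eventually.of_forall fun y => ?_
    rw [Metric.mem_closedBall, dist_eq_norm, hg, sub_nonpos]
    exact (sq_le_sq₀ (norm_nonneg _) hr.le).symm

/-- The inverse of an injective `C^m` map with invertible derivative is `C^m`. -/
theorem contDiffAt_invFunOn {m : ℕ∞ω} (hm : m ≠ 0) (hU : IsOpen U) (hf : ContDiffOn ℝ m f U)
    (hinj : InjOn f U) (hx : x ∈ U) (hdet : (fderiv ℝ f x).det ≠ 0) :
    ContDiffAt ℝ m (Function.invFunOn f U) (f x) := by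
  have hfx : ContDiffAt ℝ m f x := hf.contDiffAt (hU.mem_nhds hx)
  set A := (fderiv ℝ f x).toContinuousLinearEquivOfDetNeZero hdet with hA
  have hder : HasFDerivAt f (A : E3 →L[ℝ] E3) x := by
    rw [hA, ContinuousLinearMap.coe_toContinuousLinearEquivOfDetNeZero]
    exact (hfx.differentiableAt hm).hasFDerivAt
  have hs := hfx.hasStrictFDerivAt' hder hm
  refine (hfx.to_localInverse hder hm).congr_of_eventuallyEq ?_
  filter_upwards [hs.eventually_right_inverse, hs.localInverse_tendsto (hU.mem_nhds hx)]
    with z hz hzU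
  change Function.invFunOn f U z = hs.localInverse f A x z
  conv_lhs => rw [← hz]
  exact hinj.leftInvOn_invFunOn hzU

theorem map_nhds_eq_of_det_ne_zero (hU : IsOpen U) (hf : ContDiffOn ℝ 1 f U)
    (hx : x ∈ U) (hdet : (fderiv ℝ f x).det ≠ 0) : Filter.map f (𝓝 x) = 𝓝 (f x) := by
  have hfx : ContDiffAt ℝ 1 f x := hf.contDiffAt (hU.mem_nhds hx)
  have hs := hfx.hasStrictFDerivAt one_ne_zero
  rw [← ContinuousLinearMap.coe_toContinuousLinearEquivOfDetNeZero _ hdet] at hs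
  exact hs.map_nhds_eq_of_equiv

/-- Both sets are compact, hence closed, and `f` carries neighbourhoods of a point of `U` to
neighbourhoods of its image, so interior points correspond. -/
theorem frontier_image_eq (hU : IsOpen U) (hf : ContDiffOn ℝ 1 f U) (hinj : InjOn f U)
    (hdet : ∀ x ∈ U, (fderiv ℝ f x).det ≠ 0) (hS : IsCompact S) (hSU : S ⊆ U) :
    frontier (f '' S) = f '' frontier S := by
  have hint : ∀ x ∈ S, f x ∈ interior (f '' S) ↔ x ∈ interior S := by
    intro x hx
    rw [mem_interior_iff_mem_nhds, mem_interior_iff_mem_nhds,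
      ← map_nhds_eq_of_det_ne_zero hU hf (hSU hx) (hdet x (hSU hx)), Filter.mem_map]
    refine ⟨fun h => ?_, fun h => Filter.mem_of_superset h (subset_preimage_image f S)⟩
    filter_upwards [h, hU.mem_nhds (hSU hx)] with y hy hyU
    obtain ⟨z, hz, hzy⟩ := hy
    rwa [← hinj (hSU hz) hyU hzy]
  have hc : IsClosed (f '' S) := (hS.image_of_continuousOn (hf.continuousOn.mono hSU)).isClosed
  rw [hc.frontier_eq, hS.isClosed.frontier_eq]
  ext y
  constructor
  · rintro ⟨⟨x, hx, rfl⟩, hn⟩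
    exact ⟨x, ⟨hx, fun h => hn ((hint x hx).2 h)⟩, rfl⟩
  · rintro ⟨x, ⟨hx, hn⟩, rfl⟩
    exact ⟨⟨x, hx, rfl⟩, fun h => hn ((hint x hx).1 h)⟩

/-- A `C¹` map is locally Lipschitz. Quantifying over all subsets of `K` makes the property pass to
finite unions, so compactness concludes. -/
theorem exists_area_image_le (hU : IsOpen U) (hf : ContDiffOn ℝ 1 f U) {K : Set E3}
    (hK : IsCompact K) (hKU : K ⊆ U) :
    ∃ C : ℝ≥0, ∀ A ⊆ K, μHE[2] (f '' A) ≤ C * μHE[2] A := by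
  refine hK.induction_on (p := fun K => ∃ C : ℝ≥0, ∀ A ⊆ K, μHE[2] (f '' A) ≤ C * μHE[2] A)
    ⟨0, fun A hA => by simp [subset_empty_iff.1 hA]⟩
    (fun s t hst ⟨C, hC⟩ => ⟨C, fun A hA => hC A (hA.trans hst)⟩) ?_ ?_
  · rintro s t ⟨C, hC⟩ ⟨D, hD⟩
    refine ⟨C + D, fun A hA => ?_⟩
    have hAe : A = A ∩ s ∪ A ∩ t := by rw [← inter_union_distrib_left, inter_eq_left.2 hA]
    calc μHE[2] (f '' A) ≤ μHE[2] (f '' (A ∩ s)) + μHE[2] (f '' (A ∩ t)) := by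
          conv_lhs => rw [hAe, image_union]
          exact measure_union_le _ _
      _ ≤ C * μHE[2] A + D * μHE[2] A := by
          gcongr
          · exact (hC _ inter_subset_right).trans (by gcongr; exact inter_subset_left)
          · exact (hD _ inter_subset_right).trans (by gcongr; exact inter_subset_left)
      _ = _ := by rw [ENNReal.coe_add, add_mul]
  · intro x hx
    obtain ⟨C, t, ht, hC⟩ := (hf.contDiffAt (hU.mem_nhds (hKU hx))).exists_lipschitzOnWith
    refine ⟨t, mem_nhdsWithin_of_mem_nhds ht, C ^ 2, fun A hA => ?_⟩
    rw [ENNReal.coe_pow]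
    exact (hC.mono hA).euclideanHausdorffMeasure_image_le 2

/-- The composite of `g` with the inverse of `f` defines the image near `f x`; if its gradient
vanished, composing back with `f` would make that of `g` vanish. -/
theorem IsOutwardNormal.exists_image (h : IsOutwardNormal S x n) (hU : IsOpen U)
    (hf : ContDiffOn ℝ 1 f U) (hinj : InjOn f U)
    (hdet : ∀ x ∈ U, (fderiv ℝ f x).det ≠ 0) (hSU : S ⊆ U) :
    ∃ m, IsOutwardNormal (f '' S) (f x) m := by
  have hx := hSU h.mem
  obtain ⟨g, hg, hgx, hG, hS, -⟩ := h
  set k := Function.invFunOn f U with hk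
  have hkf : ∀ y ∈ U, k (f y) = y := fun y hy => hinj.leftInvOn_invFunOn hy
  have hkc : ContDiffAt ℝ 1 k (f x) := contDiffAt_invFunOn one_ne_zero hU hf hinj hx (hdet x hx)
  have hgk : ContDiffAt ℝ 1 (g ∘ k) (f x) :=
    ContDiffAt.comp (f x) (by rw [hkf x hx]; exact hg) hkc
  refine ⟨_, g ∘ k, hgk, by simp [hkf x hx, hgx], ?_, ?_, rfl⟩
  · intro h0
    apply hG
    have h1 : fderiv ℝ (g ∘ k) (f x) = 0 := by
      rw [gradient] at h0
      exact (LinearIsometryEquiv.map_eq_zero_iff _).1 h0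
    have h2 : HasFDerivAt ((g ∘ k) ∘ f) (0 : E3 →L[ℝ] ℝ) x := by
      have h3 : HasFDerivAt (g ∘ k) (0 : E3 →L[ℝ] ℝ) (f x) := by
        rw [← h1]; exact (hgk.differentiableAt one_ne_zero).hasFDerivAt
      simpa using h3.comp x
        ((hf.contDiffAt (hU.mem_nhds hx)).differentiableAt one_ne_zero).hasFDerivAt
    have h4 : g =ᶠ[𝓝 x] (g ∘ k) ∘ f := by
      filter_upwards [hU.mem_nhds hx] with y hy
      simp [hkf y hy]
    rw [gradient, (h2.congr_of_eventuallyEq h4).fderiv, map_zero]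
  · rw [← map_nhds_eq_of_det_ne_zero hU hf hx (hdet x hx), Filter.eventually_map]
    filter_upwards [hS, hU.mem_nhds hx] with y hy hyU
    rw [Function.comp_apply, hkf y hyU, ← hy, hinj.mem_image_iff hSU hyU]

/-- The image of a region under a diffeomorphism is a region. -/
theorem IsRegion.image (hS : IsRegion S) (hU : IsOpen U) (hf : ContDiffOn ℝ 1 f U)
    (hinj : InjOn f U) (hdet : ∀ x ∈ U, (fderiv ℝ f x).det ≠ 0) (hSU : S ⊆ U) :
    IsRegion (f '' S) := by
  have hfr := frontier_image_eq hU hf hinj hdet hS.isCompact hSU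
  have hsub := hS.isCompact.isClosed.frontier_subset
  obtain ⟨C, hC⟩ := exists_area_image_le hU hf
    (hS.isCompact.of_isClosed_subset isClosed_frontier hsub) (hsub.trans hSU)
  refine ⟨hS.isCompact.image_of_continuousOn (hf.continuousOn.mono hSU), ?_, ?_⟩
  · rw [hfr]
    exact (hC _ subset_rfl).trans_lt (ENNReal.mul_lt_top ENNReal.coe_lt_top hS.area_lt_top)
  · refine measure_mono_null (t := f '' singularSet S) ?_ ?_
    · rintro _ ⟨hy, hn⟩
      rw [hfr] at hy
      obtain ⟨x, hx, rfl⟩ := hy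
      exact ⟨x, ⟨hx, fun ⟨m, hm⟩ => hn (hm.exists_image hU hf hinj hdet hSU)⟩, rfl⟩
    · refine le_antisymm ((hC _ fun y hy => hy.1).trans ?_) zero_le
      have : μHE[2] (singularSet S) = 0 := hS.area_singular
      rw [this, mul_zero]

end Fluid

/-! ### Localisation, and differentiation under the integral sign -/

namespace Fluid

open scoped RealInnerProductSpace NNReal ENNReal Manifold ContDiff

/-- Where `f` is positive it exceeds half its value on a small ball, whose integral is then
positive; the same holds for `-f`. -/
theorem eq_zero_of_setIntegral_closedBall_eq_zero {U : Set E3} (hU : IsOpen U) {f : E3 → ℝ}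
    (hf : ContinuousOn f U)
    (h : ∀ c r, 0 < r → Metric.closedBall c r ⊆ U → ∫ y in Metric.closedBall c r, f y = 0) :
    ∀ x ∈ U, f x = 0 := by
  have key : ∀ g : E3 → ℝ, ContinuousOn g U →
      (∀ c r, 0 < r → Metric.closedBall c r ⊆ U → ∫ y in Metric.closedBall c r, g y = 0) →
      ∀ x ∈ U, g x ≤ 0 := by
    intro g hg hint x hx
    by_contra! hpos
    have hev : ∀ᶠ y in 𝓝 x, y ∈ U ∧ g x / 2 < g y :=
      (hU.eventually_mem hx).and
        ((hg.continuousAt (hU.mem_nhds hx)).eventually_const_lt (half_lt_self hpos))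
    obtain ⟨r, hr, hball⟩ := Metric.nhds_basis_closedBall.eventually_iff.1 hev
    have hsub : Metric.closedBall x r ⊆ U := fun y hy => (hball hy).1
    have h1 : ∫ _ in Metric.closedBall x r, g x / 2 ≤ ∫ y in Metric.closedBall x r, g y :=
      setIntegral_mono_on (integrableOn_const (measure_closedBall_lt_top.ne))
        ((hg.mono hsub).integrableOn_compact (isCompact_closedBall x r))
        Metric.isClosed_closedBall.measurableSet fun y hy => (hball hy).2.le
    rw [hint x r hr hsub, setIntegral_const, smul_eq_mul] at h1
    have h2 : 0 < volume.real (Metric.closedBall x r) :=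
      ENNReal.toReal_pos (Metric.measure_closedBall_pos _ x hr).ne' measure_closedBall_lt_top.ne
    have : 0 < volume.real (Metric.closedBall x r) * (g x / 2) := by positivity
    linarith
  intro x hx
  refine le_antisymm (key f hf h x hx) ?_
  have := key (fun y => -f y) hf.neg (fun c r hr hc => by rw [integral_neg, h c r hr hc, neg_zero])
    x hx
  linarith

theorem continuousOn_pderiv {V : Set E3} (hV : IsOpen V) {f : E3 → ℝ} (hf : ContDiffOn ℝ 1 f V)
    (j : Fin 3) : ContinuousOn (pderiv j f) V :=
  (hf.continuousOn_fderiv_of_isOpen hV le_rfl).clm_apply continuousOn_const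

theorem fderiv_eq_sum_pderiv {f : E3 → ℝ} (x v : E3) :
    fderiv ℝ f x v = ∑ l, v l * pderiv l f x := by
  have : v = ∑ l, v l • EuclideanSpace.single l (1 : ℝ) := by
    ext i
    simp [Finset.sum_apply, Pi.single_apply]
  conv_lhs => rw [this]
  simp [pderiv]

theorem continuousOn_divergence {V : Set E3} (hV : IsOpen V) {v : E3 → E3}
    (hv : ContDiffOn ℝ 1 v V) : ContinuousOn (divergence v) V :=
  continuousOn_finsetSum _ fun i _ => continuousOn_pderiv hV (contDiffOn_euclidean.1 hv i) i

/-- Differentiation under the integral sign over a compact set. -/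
theorem hasDerivAt_setIntegral_mul {U S : Set E3} (hU : IsOpen U) (hS : IsCompact S) (hSU : S ⊆ U)
    {w : E3 → ℝ} (hw : ContinuousOn w S) {G : ℝ × E3 → ℝ} (hG : ContDiffOn ℝ 1 G (univ ×ˢ U))
    (t : ℝ) :
    HasDerivAt (fun s => ∫ ξ in S, w ξ * G (s, ξ)) (∫ ξ in S, w ξ * fderiv ℝ G (t, ξ) (1, 0)) t := by
  have hO : IsOpen ((univ : Set ℝ) ×ˢ U) := isOpen_univ.prod hU
  have hGs : ∀ s, ContinuousOn (fun ξ => G (s, ξ)) S := fun s =>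
    hG.continuousOn.comp (by fun_prop) fun ξ hξ => ⟨mem_univ _, hSU hξ⟩
  have hdG : ContinuousOn (fun p => fderiv ℝ G p (1, 0)) (univ ×ˢ U) :=
    (hG.continuousOn_fderiv_of_isOpen hO le_rfl).clm_apply continuousOn_const
  have hcomp : IsCompact (Icc (t - 1) (t + 1) ×ˢ S) := isCompact_Icc.prod hS
  have hcont : ContinuousOn (fun p : ℝ × E3 => w p.2 * fderiv ℝ G p (1, 0))
      (Icc (t - 1) (t + 1) ×ˢ S) :=
    (hw.comp continuousOn_snd fun p hp => hp.2).mul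
      (hdG.mono (prod_mono (subset_univ _) hSU))
  obtain ⟨C, hC⟩ := hcomp.exists_bound_of_continuousOn hcont
  have hSm := hS.isClosed.measurableSet
  refine (hasDerivAt_integral_of_dominated_loc_of_deriv_le
    (F := fun s ξ => w ξ * G (s, ξ)) (F' := fun s ξ => w ξ * fderiv ℝ G (s, ξ) (1, 0))
    (bound := fun _ => C) (s := Icc (t - 1) (t + 1))
    (Icc_mem_nhds (by linarith) (by linarith)) ?_ ?_ ?_ ?_ ?_ ?_).2
  · exact Filter.Eventually.of_forall fun s => (hw.mul (hGs s)).aestronglyMeasurable hSm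
  · exact (hw.mul (hGs t)).integrableOn_compact hS
  · refine (hw.mul ?_).aestronglyMeasurable hSm
    exact hdG.comp (by fun_prop) fun ξ hξ => ⟨mem_univ _, hSU hξ⟩
  · exact (ae_restrict_iff' hSm).2 (ae_of_all _ fun ξ hξ s hs => hC (s, ξ) ⟨hs, hξ⟩)
  · exact integrableOn_const hS.measure_lt_top.ne
  · refine (ae_restrict_iff' hSm).2 (ae_of_all _ fun ξ hξ s _ => ?_)
    have h1 : HasFDerivAt G (fderiv ℝ G (s, ξ)) (s, ξ) :=
      ((hG.contDiffAt (hO.mem_nhds ⟨mem_univ _, hSU hξ⟩)).differentiableAt one_ne_zero).hasFDerivAt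
    have h2 : HasDerivAt (fun s : ℝ => (s, ξ)) ((1 : ℝ), (0 : E3)) s :=
      (hasDerivAt_id s).prodMk (hasDerivAt_const s ξ)
    exact (h1.comp_hasDerivAt s h2).const_mul (w ξ)

/-! ### Lagrangian description of the motion -/

namespace Motion

variable (M : Motion)

theorem contDiffOn_φ_slice (t : ℝ) : ContDiffOn ℝ 3 (M.φ t) M.U :=
  M.contDiffOn_φ.comp (contDiff_prodMk_right t).contDiffOn fun _ hξ => ⟨mem_univ t, hξ⟩

theorem isOpen_space_time : IsOpen ((univ : Set ℝ) ×ˢ M.U) := isOpen_univ.prod M.isOpen_U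

theorem hasFDerivAt_φ {t : ℝ} {ξ : E3} (hξ : ξ ∈ M.U) :
    HasFDerivAt (fun p : ℝ × E3 => M.φ p.1 p.2)
      (fderiv ℝ (fun p : ℝ × E3 => M.φ p.1 p.2) (t, ξ)) (t, ξ) :=
  ((M.contDiffOn_φ.contDiffAt (M.isOpen_space_time.mem_nhds ⟨mem_univ t, hξ⟩)).differentiableAt
    (by norm_num)).hasFDerivAt

theorem hasDerivAt_φ {t : ℝ} {ξ : E3} (hξ : ξ ∈ M.U) :
    HasDerivAt (fun s => M.φ s ξ)
      (fderiv ℝ (fun p : ℝ × E3 => M.φ p.1 p.2) (t, ξ) (1, 0)) t :=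
  (M.hasFDerivAt_φ hξ).comp_hasDerivAt (f := fun s => (s, ξ)) t ((hasDerivAt_id t).prodMk (hasDerivAt_const t ξ))

theorem label_φ {t : ℝ} {ξ : E3} (hξ : ξ ∈ M.U) : M.label t (M.φ t ξ) = ξ :=
  (M.injOn_φ t).leftInvOn_invFunOn hξ

theorem velocity_φ {t : ℝ} {ξ : E3} (hξ : ξ ∈ M.U) :
    M.velocity t (M.φ t ξ) = fderiv ℝ (fun p : ℝ × E3 => M.φ p.1 p.2) (t, ξ) (1, 0) := by
  rw [velocity, M.label_φ hξ, (M.hasDerivAt_φ hξ).deriv]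

theorem fderiv_φ_slice {t : ℝ} {ξ : E3} (hξ : ξ ∈ M.U) (v : E3) :
    fderiv ℝ (M.φ t) ξ v = fderiv ℝ (fun p : ℝ × E3 => M.φ p.1 p.2) (t, ξ) (0, v) := by
  have h1 : HasFDerivAt (fun ξ : E3 => (t, ξ)) (ContinuousLinearMap.inr ℝ ℝ E3) ξ :=
    hasFDerivAt_prodMk_right t ξ
  have h2 := (M.hasFDerivAt_φ (t := t) hξ).comp ξ h1
  have h3 : fderiv ℝ (M.φ t) ξ = _ := h2.fderiv
  rw [h3]
  simp

theorem isOpen_image (t : ℝ) : IsOpen (M.φ t '' M.U) := by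
  rw [isOpen_iff_mem_nhds]
  rintro _ ⟨ξ, hξ, rfl⟩
  rw [← map_nhds_eq_of_det_ne_zero M.isOpen_U ((M.contDiffOn_φ_slice t).of_le (by norm_num)) hξ
    (M.jacobian_ne_zero t ξ hξ)]
  exact Filter.image_mem_map (M.isOpen_U.mem_nhds hξ)

/-- The set is the image of `univ ×ˢ M.U` under `(t, ξ) ↦ (t, φ t ξ)`. The derivative of that map is
block triangular with invertible blocks, hence surjective, so the map is open. -/
theorem isOpen_domain : IsOpen M.domain := by
  rw [isOpen_iff_mem_nhds]
  rintro ⟨t, x⟩ ⟨ξ, hξ, hx⟩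
  obtain rfl : M.φ t ξ = x := hx
  set A := fderiv ℝ (fun p : ℝ × E3 => M.φ p.1 p.2) (t, ξ) with hA
  have hst : HasStrictFDerivAt (fun p : ℝ × E3 => (p.1, M.φ p.1 p.2))
      ((ContinuousLinearMap.fst ℝ ℝ E3).prod A) (t, ξ) :=
    hasStrictFDerivAt_fst.prodMk ((M.contDiffOn_φ.contDiffAt (M.isOpen_space_time.mem_nhds
      ⟨mem_univ t, hξ⟩)).hasStrictFDerivAt (by norm_num))
  have hsurj : ((ContinuousLinearMap.fst ℝ ℝ E3).prod A).range = ⊤ := by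
    rw [LinearMap.range_eq_top]
    rintro ⟨s, v⟩
    set B := (fderiv ℝ (M.φ t) ξ).toContinuousLinearEquivOfDetNeZero (M.jacobian_ne_zero t ξ hξ)
    refine ⟨(s, B.symm (v - A (s, 0))), ?_⟩
    have h1 : A (0, B.symm (v - A (s, 0))) = v - A (s, 0) := by
      rw [hA, ← M.fderiv_φ_slice hξ]
      exact B.apply_symm_apply _
    have h2 : A (s, B.symm (v - A (s, 0))) = v := by
      have : ((s, B.symm (v - A (s, 0))) : ℝ × E3) = (s, 0) + (0, B.symm (v - A (s, 0))) := by simp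
      rw [this, map_add, h1]; abel
    simp only [ContinuousLinearMap.coe_coe, ContinuousLinearMap.prod_apply,
      ContinuousLinearMap.coe_fst']
    rw [h2]
  have hmap := hst.map_nhds_eq_of_surj hsurj
  have h3 : (fun p : ℝ × E3 => (p.1, M.φ p.1 p.2)) (t, ξ) = (t, M.φ t ξ) := rfl
  simp only [] at hmap
  rw [← hmap]
  filter_upwards [Filter.image_mem_map (M.isOpen_space_time.mem_nhds
    (show (t, ξ) ∈ univ ×ˢ M.U from ⟨mem_univ t, hξ⟩))]
  rintro _ ⟨⟨s, η⟩, ⟨-, hη⟩, rfl⟩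
  exact ⟨η, hη, rfl⟩

theorem contDiffOn_label (t : ℝ) : ContDiffOn ℝ 3 (M.label t) (M.φ t '' M.U) := by
  rintro _ ⟨ξ, hξ, rfl⟩
  exact (contDiffAt_invFunOn (by norm_num) M.isOpen_U (M.contDiffOn_φ_slice t) (M.injOn_φ t) hξ
    (M.jacobian_ne_zero t ξ hξ)).contDiffWithinAt

theorem contDiffOn_velocity (t : ℝ) : ContDiffOn ℝ 1 (M.velocity t) (M.φ t '' M.U) := by
  have h1 : ContDiffOn ℝ 1 (fun p => fderiv ℝ (fun p : ℝ × E3 => M.φ p.1 p.2) p (1, 0))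
      (univ ×ˢ M.U) :=
    (M.contDiffOn_φ.fderiv_of_isOpen M.isOpen_space_time (by norm_num)).clm_apply contDiffOn_const
  have h2 : ContDiffOn ℝ 1 (fun x => (t, M.label t x)) (M.φ t '' M.U) :=
    contDiffOn_const.prodMk ((M.contDiffOn_label t).of_le (by norm_num))
  refine (h1.comp h2 ?_).congr ?_
  · rintro _ ⟨ξ, hξ, rfl⟩
    exact ⟨mem_univ t, by change M.label t (M.φ t ξ) ∈ M.U; rwa [M.label_φ hξ]⟩
  · rintro _ ⟨ξ, hξ, rfl⟩
    rw [M.velocity_φ hξ, Function.comp_apply, M.label_φ hξ]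

variable {S : Set E3}

theorem moved_subset (hSU : S ⊆ M.U) (t : ℝ) : M.moved S t ⊆ M.φ t '' M.U := image_mono hSU

theorem isRegion_moved (hS : IsRegion S) (hSU : S ⊆ M.U) (t : ℝ) : IsRegion (M.moved S t) :=
  hS.image M.isOpen_U ((M.contDiffOn_φ_slice t).of_le (by norm_num)) (M.injOn_φ t)
    (M.jacobian_ne_zero t) hSU

/-- The Jacobian of the motion. -/
def jacobian (t : ℝ) (ξ : E3) : ℝ := |(fderiv ℝ (M.φ t) ξ).det|

theorem continuousOn_jacobian (t : ℝ) : ContinuousOn (M.jacobian t) M.U :=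
  (ContinuousLinearMap.continuous_det.comp_continuousOn
    ((M.contDiffOn_φ_slice t).continuousOn_fderiv_of_isOpen M.isOpen_U (by norm_num))).abs

theorem jacobian_pos (t : ℝ) {ξ : E3} (hξ : ξ ∈ M.U) : 0 < M.jacobian t ξ :=
  abs_pos.2 (M.jacobian_ne_zero t ξ hξ)

theorem setIntegral_moved (hS : MeasurableSet S) (hSU : S ⊆ M.U) (t : ℝ) (f : E3 → ℝ) :
    ∫ x in M.moved S t, f x = ∫ ξ in S, M.jacobian t ξ * f (M.φ t ξ) := by
  rw [moved, integral_image_eq_integral_abs_det_fderiv_smul volume hS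
    (fun ξ hξ => (((M.contDiffOn_φ_slice t).contDiffAt (M.isOpen_U.mem_nhds
      (hSU hξ))).differentiableAt (by norm_num)).hasFDerivAt.hasFDerivWithinAt)
    ((M.injOn_φ t).mono hSU)]
  rfl

theorem continuousOn_slice {f : ℝ → E3 → ℝ}
    (hf : ContinuousOn (fun p : ℝ × E3 => f p.1 p.2) M.domain) (t : ℝ) :
    ContinuousOn (f t) (M.φ t '' M.U) :=
  hf.comp (f := fun x => (t, x)) (by fun_prop) fun _ hx => hx

theorem contDiffOn_slice {F : Type*} [NormedAddCommGroup F] [NormedSpace ℝ F] {f : ℝ → E3 → F}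
    (hf : ContDiffOn ℝ 1 (fun p : ℝ × E3 => f p.1 p.2) M.domain) (t : ℝ) :
    ContDiffOn ℝ 1 (f t) (M.φ t '' M.U) :=
  hf.comp (contDiff_prodMk_right t).contDiffOn fun _ hx => hx

variable {ρ E : ℝ → E3 → ℝ}

/-- Conservation of mass in Lagrangian form. -/
theorem ConservesMass.density_mul_jacobian (h : M.ConservesMass ρ)
    (hρ : ContinuousOn (fun p : ℝ × E3 => ρ p.1 p.2) M.domain) (t : ℝ) {ξ : E3} (hξ : ξ ∈ M.U) :
    M.jacobian t ξ * ρ t (M.φ t ξ) = M.jacobian 0 ξ * ρ 0 (M.φ 0 ξ) := by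
  have hcont : ∀ s, ContinuousOn (fun ξ => M.jacobian s ξ * ρ s (M.φ s ξ)) M.U := fun s =>
    (M.continuousOn_jacobian s).mul ((M.continuousOn_slice hρ s).comp
      (M.contDiffOn_φ_slice s).continuousOn (mapsTo_image _ _))
  rw [← sub_eq_zero]
  -- The mass that starts in a ball is constant in time; pulled back to labels, this says that the
  -- difference at times `t` and `0` integrates to zero over every ball in `U`.
  refine eq_zero_of_setIntegral_closedBall_eq_zero M.isOpen_U ((hcont t).sub (hcont 0))
    (fun c r hr hsub => ?_) ξ hξ
  have hm : MeasurableSet (Metric.closedBall c r) := Metric.isClosed_closedBall.measurableSet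
  have hder := h _ (isRegion_closedBall c hr) hsub
  have hconst := is_const_of_deriv_eq_zero (fun s => (hder s).differentiableAt)
    (fun s => (hder s).deriv) t 0
  rw [mass, mass, M.setIntegral_moved hm hsub, M.setIntegral_moved hm hsub] at hconst
  have hint : ∀ s, IntegrableOn (fun ξ => M.jacobian s ξ * ρ s (M.φ s ξ))
      (Metric.closedBall c r) volume := fun s =>
    ((hcont s).mono hsub).integrableOn_compact (isCompact_closedBall c r)
  simp only [Pi.sub_apply]
  rw [integral_sub (hint t) (hint 0), hconst, sub_self]

/-- The material derivative is the derivative along particle paths. -/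
theorem fderiv_comp_φ_eq_materialDeriv
    (hE : ContDiffOn ℝ 1 (fun p : ℝ × E3 => E p.1 p.2) M.domain) (t : ℝ) {ξ : E3} (hξ : ξ ∈ M.U) :
    fderiv ℝ (fun p : ℝ × E3 => E p.1 (M.φ p.1 p.2)) (t, ξ) (1, 0)
      = M.materialDeriv E t (M.φ t ξ) := by
  have hmem : (t, M.φ t ξ) ∈ M.domain := ⟨ξ, hξ, rfl⟩
  set x := M.φ t ξ with hx
  set L := fderiv ℝ (fun p : ℝ × E3 => E p.1 p.2) (t, x) with hL
  have hEd : HasFDerivAt (fun p : ℝ × E3 => E p.1 p.2) L (t, x) :=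
    ((hE.contDiffAt (M.isOpen_domain.mem_nhds hmem)).differentiableAt one_ne_zero).hasFDerivAt
  have h1 : HasFDerivAt (fun p : ℝ × E3 => (p.1, M.φ p.1 p.2))
      ((ContinuousLinearMap.fst ℝ ℝ E3).prod
        (fderiv ℝ (fun p : ℝ × E3 => M.φ p.1 p.2) (t, ξ))) (t, ξ) :=
    hasFDerivAt_fst.prodMk (M.hasFDerivAt_φ hξ)
  have h2 : fderiv ℝ (fun p : ℝ × E3 => E p.1 (M.φ p.1 p.2)) (t, ξ) = _ :=
    (HasFDerivAt.comp (t, ξ) (f := fun p : ℝ × E3 => (p.1, M.φ p.1 p.2)) hEd h1).fderiv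
  have h3 : deriv (fun s => E s x) t = L (1, 0) :=
    (hEd.comp_hasDerivAt (f := fun s => (s, x)) t
      ((hasDerivAt_id t).prodMk (hasDerivAt_const t x))).deriv
  have h4 : fderiv ℝ (E t) x = L.comp (ContinuousLinearMap.inr ℝ ℝ E3) :=
    (hEd.comp (f := fun y => (t, y)) x (hasFDerivAt_prodMk_right t x)).fderiv
  rw [materialDeriv, h3, ← fderiv_eq_sum_pderiv, h4, h2, hx, M.velocity_φ hξ]
  simp only [ContinuousLinearMap.comp_apply, ContinuousLinearMap.prod_apply,
    ContinuousLinearMap.coe_fst', ContinuousLinearMap.inr_apply]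
  rw [← map_add]
  simp

/-- The rate of change of the internal energy of a moving region. -/
theorem hasDerivAt_internalEnergy (hm : M.ConservesMass ρ)
    (hρ : ContinuousOn (fun p : ℝ × E3 => ρ p.1 p.2) M.domain)
    (hE : ContDiffOn ℝ 1 (fun p : ℝ × E3 => E p.1 p.2) M.domain)
    (hS : IsRegion S) (hSU : S ⊆ M.U) (t : ℝ) :
    HasDerivAt (M.internalEnergy ρ E S)
      (∫ x in M.moved S t, ρ t x * M.materialDeriv E t x) t := by
  have hSm := hS.isCompact.isClosed.measurableSet
  have hw : ContinuousOn (fun ξ => M.jacobian 0 ξ * ρ 0 (M.φ 0 ξ)) S :=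
    ((M.continuousOn_jacobian 0).mul ((M.continuousOn_slice hρ 0).comp
      (M.contDiffOn_φ_slice 0).continuousOn (mapsTo_image _ _))).mono hSU
  have hG : ContDiffOn ℝ 1 (fun p : ℝ × E3 => E p.1 (M.φ p.1 p.2)) (univ ×ˢ M.U) :=
    hE.comp (f := fun p : ℝ × E3 => (p.1, M.φ p.1 p.2))
      (contDiffOn_fst.prodMk (M.contDiffOn_φ.of_le (by norm_num)))
      fun p hp => ⟨p.2, hp.2, rfl⟩
  have h1 := hasDerivAt_setIntegral_mul M.isOpen_U hS.isCompact hSU hw hG t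
  -- The weight is frozen at its value at time `0`, so neither the density nor the Jacobian has to
  -- be differentiated.
  have h2 : M.internalEnergy ρ E S
      = fun s => ∫ ξ in S, M.jacobian 0 ξ * ρ 0 (M.φ 0 ξ) * E s (M.φ s ξ) := by
    funext s
    rw [internalEnergy, M.setIntegral_moved hSm hSU]
    refine setIntegral_congr_fun hSm fun ξ hξ => ?_
    rw [← mul_assoc, hm.density_mul_jacobian M hρ s (hSU hξ)]
  rw [h2, M.setIntegral_moved hSm hSU]
  convert! h1 using 1
  refine setIntegral_congr_fun hSm fun ξ hξ => ?_
  rw [← mul_assoc, hm.density_mul_jacobian M hρ t (hSU hξ),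
    M.fderiv_comp_φ_eq_materialDeriv hE t (hSU hξ)]

theorem continuousOn_materialDeriv
    (hE : ContDiffOn ℝ 1 (fun p : ℝ × E3 => E p.1 p.2) M.domain) (t : ℝ) :
    ContinuousOn (M.materialDeriv E t) (M.φ t '' M.U) := by
  have hdE : ContinuousOn (fun x => fderiv ℝ (fun p : ℝ × E3 => E p.1 p.2) (t, x) (1, 0))
      (M.φ t '' M.U) :=
    ((hE.continuousOn_fderiv_of_isOpen M.isOpen_domain le_rfl).comp (f := fun x => (t, x))
      (by fun_prop) fun _ hx => hx).clm_apply continuousOn_const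
  refine ContinuousOn.add (hdE.congr fun x hx => ?_) (continuousOn_finsetSum _ fun l _ => ?_)
  · exact ((((hE.contDiffAt (M.isOpen_domain.mem_nhds hx)).differentiableAt
      one_ne_zero).hasFDerivAt).comp_hasDerivAt (f := fun s => (s, x)) t
      ((hasDerivAt_id t).prodMk (hasDerivAt_const t x))).deriv
  · exact (contDiffOn_euclidean.1 (M.contDiffOn_velocity t) l).continuousOn.mul
      (continuousOn_pderiv (M.isOpen_image t) (M.contDiffOn_slice hE t) l)

variable {T : ℝ → E3 → Matrix (Fin 3) (Fin 3) ℝ}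

theorem continuousOn_deformationPower
    (hT : ∀ i j, ContinuousOn (fun p : ℝ × E3 => T p.1 p.2 i j) M.domain) (t : ℝ) :
    ContinuousOn (M.deformationPower T t) (M.φ t '' M.U) := by
  have hu : ∀ i j, ContinuousOn (pderiv j fun y => M.velocity t y i) (M.φ t '' M.U) := fun i j =>
    continuousOn_pderiv (M.isOpen_image t) (contDiffOn_euclidean.1 (M.contDiffOn_velocity t) i) j
  have hT' : ∀ i j, ContinuousOn (fun x => T t x i j) (M.φ t '' M.U) := fun i j =>
    M.continuousOn_slice (f := fun t x => T t x i j) (hT i j) t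
  exact continuousOn_finsetSum _ fun i _ => continuousOn_finsetSum _ fun j _ =>
    (((hu i j).add (hu j i)).div_const 2).mul (((hT' i j).add (hT' j i)).div_const 2)

theorem continuousOn_rotationPower
    (hT : ∀ i j, ContinuousOn (fun p : ℝ × E3 => T p.1 p.2 i j) M.domain) (t : ℝ) :
    ContinuousOn (M.rotationPower T t) (M.φ t '' M.U) := by
  have hu : ∀ i j, ContinuousOn (pderiv j fun y => M.velocity t y i) (M.φ t '' M.U) := fun i j =>
    continuousOn_pderiv (M.isOpen_image t) (contDiffOn_euclidean.1 (M.contDiffOn_velocity t) i) j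
  have hT' : ∀ i j, ContinuousOn (fun x => T t x i j) (M.φ t '' M.U) := fun i j =>
    M.continuousOn_slice (f := fun t x => T t x i j) (hT i j) t
  exact continuousOn_finsetSum _ fun i _ => continuousOn_finsetSum _ fun j _ =>
    (((hu i j).sub (hu j i)).div_const 2).mul (((hT' i j).sub (hT' j i)).div_const 2)

theorem heatOutflow_eq {q : ℝ → E3 → E3}
    (hq : ContDiffOn ℝ 1 (fun p : ℝ × E3 => q p.1 p.2) M.domain)
    (hS : IsRegion S) (hSU : S ⊆ M.U) (t : ℝ) :
    M.heatOutflow q S t = ∫ x in M.moved S t, divergence (q t) x :=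
  ((M.isRegion_moved hS hSU t).setIntegral_divergence (M.isOpen_image t) (M.moved_subset hSU t)
    (M.contDiffOn_slice hq t)).symm

end Motion

end Fluid

end

/-! ### The equivalence -/

theorem mainTheorem7 (M : Fluid.Motion)
    (ρ E : ℝ → Fluid.E3 → ℝ)
    (F q : ℝ → Fluid.E3 → Fluid.E3)
    (T : ℝ → Fluid.E3 → Matrix (Fin 3) (Fin 3) ℝ)
    (hρ : ContDiffOn ℝ 1 (fun p : ℝ × Fluid.E3 => ρ p.1 p.2) M.domain)
    (hρ_pos : ∀ t x, (t, x) ∈ M.domain → 0 < ρ t x)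
    (hE : ContDiffOn ℝ 1 (fun p : ℝ × Fluid.E3 => E p.1 p.2) M.domain)
    (hF : ContinuousOn (fun p : ℝ × Fluid.E3 => F p.1 p.2) M.domain)
    (hq : ContDiffOn ℝ 1 (fun p : ℝ × Fluid.E3 => q p.1 p.2) M.domain)
    (hT : ∀ i j, ContDiffOn ℝ 1 (fun p : ℝ × Fluid.E3 => T p.1 p.2 i j) M.domain)
    (h_mass : M.ConservesMass ρ)
    (h_transfer : M.EnergyTransfer ρ F T) :
    M.TotalEnergyEquation ρ E T q ↔ M.FirstLaw ρ E F T q := by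
  have hT' := fun i j => (hT i j).continuousOn
  have c1 : ∀ t, ContinuousOn (fun x => ρ t x * M.materialDeriv E t x) (M.φ t '' M.U) := fun t =>
    (M.continuousOn_slice hρ.continuousOn t).mul (M.continuousOn_materialDeriv hE t)
  have c2 := M.continuousOn_deformationPower hT'
  have c3 := M.continuousOn_rotationPower hT'
  have c4 : ∀ t, ContinuousOn (Fluid.divergence (q t)) (M.φ t '' M.U) := fun t =>
    Fluid.continuousOn_divergence (M.isOpen_image t) (M.contDiffOn_slice hq t)
  set f : ℝ → Fluid.E3 → ℝ := fun t x => ρ t x * M.materialDeriv E t x - M.deformationPower T t x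
    - M.rotationPower T t x + Fluid.divergence (q t) x with hf
  have cf : ∀ t, ContinuousOn (f t) (M.φ t '' M.U) := fun t =>
    (((c1 t).sub (c2 t)).sub (c3 t)).add (c4 t)
  have hint : ∀ S, Fluid.IsRegion S → S ⊆ M.U → ∀ t, ∫ x in M.moved S t, f t x =
      (∫ x in M.moved S t, ρ t x * M.materialDeriv E t x)
        - (∫ x in M.moved S t, M.deformationPower T t x)
        - (∫ x in M.moved S t, M.rotationPower T t x) + M.heatOutflow q S t := by
    intro S hS hSU t
    have hK := (M.isRegion_moved hS hSU t).isCompact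
    have hI : ∀ {g : Fluid.E3 → ℝ}, ContinuousOn g (M.φ t '' M.U) →
        IntegrableOn g (M.moved S t) volume := fun hg =>
      (hg.mono (M.moved_subset hSU t)).integrableOn_compact hK
    have i2 : IntegrableOn (fun x => ρ t x * M.materialDeriv E t x - M.deformationPower T t x)
      (M.moved S t) volume := hI ((c1 t).sub (c2 t))
    have i3 : IntegrableOn (fun x => ρ t x * M.materialDeriv E t x - M.deformationPower T t x
      - M.rotationPower T t x) (M.moved S t) volume := hI (((c1 t).sub (c2 t)).sub (c3 t))
    rw [M.heatOutflow_eq hq hS hSU, ← integral_sub (hI (c1 t)) (hI (c2 t)),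
      ← integral_sub i2 (hI (c3 t)), ← integral_add i3 (hI (c4 t))]
  -- This holds without either side of the equivalence: the integral of `f` measures the defect in
  -- the first law.
  have hsum : ∀ S, Fluid.IsRegion S → S ⊆ M.U → ∀ t, HasDerivAt
      (fun s => M.kineticEnergy ρ S s + M.internalEnergy ρ E S s)
      (M.externalPower ρ F S t + M.stressPower T S t - M.heatOutflow q S t
        + ∫ x in M.moved S t, f t x) t := by
    intro S hS hSU t
    convert! (h_transfer S hS hSU t).add
      (M.hasDerivAt_internalEnergy h_mass hρ.continuousOn hE hS hSU t) using 1
    rw [hint S hS hSU t]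
    ring
  constructor
  · intro h S hS hSU t
    have h0 : ∫ x in M.moved S t, f t x = 0 := by
      refine setIntegral_eq_zero_of_forall_eq_zero fun x hx => ?_
      have := h t x (M.moved_subset hSU t hx)
      simp only [hf]
      linarith
    simpa [h0] using hsum S hS hSU t
  · rintro h t x ⟨ξ, hξ, hx⟩
    obtain rfl : M.φ t ξ = x := hx
    -- Moving regions are indexed by their initial shape, so `f` is tested on balls of labels;
    -- pulling back brings in the Jacobian, which is positive and cancels.
    have hzero : M.jacobian t ξ * f t (M.φ t ξ) = 0 := by
      refine Fluid.eq_zero_of_setIntegral_closedBall_eq_zero M.isOpen_U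
        ((M.continuousOn_jacobian t).mul ((cf t).comp (M.contDiffOn_φ_slice t).continuousOn
          (mapsTo_image _ _))) (fun c r hr hsub => ?_) ξ hξ
      have hS := Fluid.isRegion_closedBall c hr
      have h1 := (hsum _ hS hsub t).unique (h _ hS hsub t)
      rw [M.setIntegral_moved Metric.isClosed_closedBall.measurableSet hsub] at h1
      exact left_eq_add.1 h1.symm
    have := (mul_eq_zero.1 hzero).resolve_left (M.jacobian_pos t hξ).ne'
    simp only [hf] at this
    linarith
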